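/- For $k\in\mathbb Z$ let $\lambda_k(x)=\left(\frac{ix-1}{ix+1}\right)^k$, $x\in\mathbb R$. For $\alpha\in(0,2)$ let $$(-\Delta)^{\alpha/2}u(x)=c_\alpha\,\mathrm{p.v.}\!\int_{-\infty}^{\infty}\frac{u(x)-u(x+y)}{|y|^{1+\alpha}}\,dy,\qquad c_\alpha=\alpha\frac{2^{\alpha-1}\Gamma(\frac12+\frac\alpha2)}{\sqrt\pi\,\Gamma(1-\frac\alpha2)} .$$ For $\alpha\in(0,2)$ and $|\gamma|\le\min\{\alpha,2-\alpha\}$ let $c^1_{\gamma,\alpha}=\frac{\Gamma(1+\alpha)}{\pi}\sin\left((\alpha-\gamma)\frac\pi2\right)$, $c^2_{\gamma,\alpha}=\frac{\Gamma(1+\alpha)}{\pi}\sin\left((\alpha+\gamma)\frac\pi2\right)$, and define the Riesz–Feller operator $D^\alpha_\gamma$ as follows. - If $0<\alpha<1$, $D_\gamma^\alpha[u](x)=\Gamma(-\alpha)\left(c^1_{\gamma,\alpha}\mathcal D^\alpha[u](x)-c^2_{\gamma,\alpha}\overline{\mathcal D^\alpha}[u](x)\right)$, where $\mathcal D^\alpha[u](x)=\frac1{\Gamma(1-\alpha)}\int_0^\infty\frac{u'(x-z)}{z^\alpha}dz$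 and $\overline{\mathcal D^\alpha}[u](x)=\frac1{\Gamma(1-\alpha)}\int_0^\infty\frac{u'(x+z)}{z^\alpha}dz$. - If $1<\alpha<2$, $D_\gamma^\alpha[u](x)=\Gamma(-\alpha)\left(c^1_{\gamma,\alpha}\,\partial_x\mathcal D^{\alpha-1}[u](x)+c^2_{\gamma,\alpha}\,\partial_x\overline{\mathcal D^{\alpha-1}}[u](x)\right)$, where $\partial_x\mathcal D^{\alpha-1}[u](x)=\frac1{\Gamma(-\alpha)}\int_0^\infty\frac{u(x-z)-u(x)+u'(x)z}{z^{1+\alpha}}dz$ and $\partial_x\overline{\mathcal D^{\alpha-1}}[u](x)=\frac1{\Gamma(-\alpha)}\int_0^\infty\frac{u(x+z)-u(x)-u'(x)z}{z^{1+\alpha}}dz$. - If $\alpha=1$, $D_\gamma^1[u](x)=-\cos\left(\gamma\frac\pi2\right)\frac{d}{dx}\mathcal H(u)(x)+\sin\left(\gamma\frac\pi2\right)u'(x)$, where $\mathcal H(u)(x)=\frac1\pi\,\mathrm{p.v.}\!\int_{-\infty}^\infty\frac{u(z)}{x-z}dz$ is the Hilbert transform, the principal value being taken at $z=x$ and at infinity.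 **Theorem.** Let $\alpha\in(0,2)$, $|\gamma|\le\min\{\alpha,2-\alpha\}$, $k\in\mathbb Z$ and $x\in\mathbb R$. Then all the integrals, principal values and derivatives defining $(-\Delta)^{\alpha/2}\lambda_k(x)$ and $D_\gamma^\alpha[\lambda_k](x)$ exist, and $$D_\gamma^\alpha[\lambda_k](x)=-e^{i\,\mathrm{sgn}(k)\gamma\frac\pi2}(-\Delta)^{\alpha/2}\lambda_k(x)=\frac{2e^{i\,\mathrm{sgn}(k)\gamma\frac\pi2}|k|\,\Gamma(1+\alpha)}{(i\,\mathrm{sgn}(k)x+1)^{1+\alpha}}\;{}_2F_1\!\left(1-|k|,1+\alpha;2;\frac{2}{i\,\mathrm{sgn}(k)x+1}\right),$$ where $\mathrm{sgn}(0)=0$, the complex power is the principal one, ${}_2F_1(a,b;c;z)=\sum_{n\ge0}\frac{(a)_n(b)_n}{(c)_n}\frac{z^n}{n!}$ (a finite sum here if $k\ne0$), and the last expression is read as $0$ if $k=0$. Moreover, if $\alpha=1$, $$D_\gamma^1[\lambda_k](x)=-\frac{2e^{i\,\mathrm{sgn}(k)\gamma\frac\pi2}|k|\,(x+i)^{2k}}{(1+x^2)^{1+k}}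 .$$ -/

import Mathlib

open Real Set Filter Topology MeasureTheory

noncomputable section

/-- The complex Higgins function `((i x - 1) / (i x + 1)) ^ k`, for an integer `k`. -/
def higgins (k : ℤ) (x : ℝ) : ℂ :=
  ((Complex.I * x - 1) / (Complex.I * x + 1)) ^ k

/-! ### The fractional Laplacian -/

/-- The constant `c_α` of the fractional Laplacian. -/
def fracLapConst (α : ℝ) : ℝ :=
  α * (2 ^ (α - 1) * Real.Gamma (1 / 2 + α / 2)) / (√π * Real.Gamma (1 - α / 2))

/-- The integrand `(u(x) - u(x + y)) / |y| ^ (1 + α)`. -/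
def fracLapIntegrand (α : ℝ) (u : ℝ → ℂ) (x y : ℝ) : ℂ :=
  (u x - u (x + y)) / ((|y| ^ (1 + α) : ℝ) : ℂ)

/-- The integral of `fracLapIntegrand` over `|y| > ε`. -/
def fracLapTrunc (α : ℝ) (u : ℝ → ℂ) (x ε : ℝ) : ℂ :=
  ∫ y in {y : ℝ | ε < |y|}, fracLapIntegrand α u x y

/-- The principal value integral defining `(-Δ)^(α/2) u (x)` exists: the truncated integrals
converge absolutely and have a limit as the truncation is removed. -/
def FracLapExists (α : ℝ) (u : ℝ → ℂ) (x : ℝ) : Prop :=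
  (∀ ε : ℝ, 0 < ε → IntegrableOn (fracLapIntegrand α u x) {y : ℝ | ε < |y|}) ∧
    ∃ L : ℂ, Tendsto (fracLapTrunc α u x) (𝓝[>] 0) (𝓝 L)

/-- `(-Δ)^(α/2) u (x) = c_α p.v. ∫ (u(x) - u(x + y)) / |y| ^ (1 + α) dy`. -/
def fracLap (α : ℝ) (u : ℝ → ℂ) (x : ℝ) : ℂ :=
  (fracLapConst α : ℂ) * limUnder (𝓝[>] (0 : ℝ)) (fracLapTrunc α u x)

/-! ### The Hilbert transform -/

/-- The integral of `u(z) / (x - z)` over `ε < |x - z| < R`, where `p = (ε, R)`. -/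
def hilbertTrunc (u : ℝ → ℂ) (x : ℝ) (p : ℝ × ℝ) : ℂ :=
  ∫ z in {z : ℝ | p.1 < |x - z| ∧ |x - z| < p.2}, u z / ((x : ℂ) - z)

/-- The principal value integral (at `z = x` and at infinity) defining the Hilbert transform of `u`
at `x` exists. -/
def HilbertExists (u : ℝ → ℂ) (x : ℝ) : Prop :=
  (∀ ε R : ℝ, 0 < ε →
      IntegrableOn (fun z : ℝ => u z / ((x : ℂ) - z)) {z : ℝ | ε < |x - z| ∧ |x - z| < R}) ∧
    ∃ L : ℂ, Tendsto (hilbertTrunc u x) (𝓝[>] 0 ×ˢ atTop) (𝓝 L)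

/-- The Hilbert transform `(1 / π) p.v. ∫ u(z) / (x - z) dz`. -/
def hilbertTransform (u : ℝ → ℂ) (x : ℝ) : ℂ :=
  (1 / (π : ℂ)) * limUnder (𝓝[>] (0 : ℝ) ×ˢ (atTop : Filter ℝ)) (hilbertTrunc u x)

/-! ### Weyl-Marchaud derivatives -/

/-- Right Weyl-Marchaud derivative `𝒟^α[u](x) = 1/Γ(1-α) ∫_0^∞ u'(x - z) / z^α dz`,
`0 < α < 1`. -/
def weylMarchaud (α : ℝ) (u : ℝ → ℂ) (x : ℝ) : ℂ :=
  (1 / (Real.Gamma (1 - α) : ℂ)) * ∫ z in Ioi (0 : ℝ), deriv u (x - z) / ((z ^ α : ℝ) : ℂ)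

/-- Minus the left Weyl-Marchaud derivative, `1/Γ(1-α) ∫_0^∞ u'(x + z) / z^α dz`,
`0 < α < 1`. -/
def weylMarchaudBar (α : ℝ) (u : ℝ → ℂ) (x : ℝ) : ℂ :=
  (1 / (Real.Gamma (1 - α) : ℂ)) * ∫ z in Ioi (0 : ℝ), deriv u (x + z) / ((z ^ α : ℝ) : ℂ)

/-- `∂ₓ𝒟^β[u](x) = 1/Γ(-1-β) ∫_0^∞ (u(x - z) - u(x) + u'(x) z) / z^(2+β) dz`, `0 < β < 1`. -/
def dWeylMarchaud (β : ℝ) (u : ℝ → ℂ) (x : ℝ) : ℂ :=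
  (1 / (Real.Gamma (-1 - β) : ℂ)) *
    ∫ z in Ioi (0 : ℝ), (u (x - z) - u x + deriv u x * z) / ((z ^ (2 + β) : ℝ) : ℂ)

/-- The analogue of `dWeylMarchaud` for `weylMarchaudBar`:
`1/Γ(-1-β) ∫_0^∞ (u(x + z) - u(x) - u'(x) z) / z^(2+β) dz`, `0 < β < 1`. -/
def dWeylMarchaudBar (β : ℝ) (u : ℝ → ℂ) (x : ℝ) : ℂ :=
  (1 / (Real.Gamma (-1 - β) : ℂ)) *
    ∫ z in Ioi (0 : ℝ), (u (x + z) - u x - deriv u x * z) / ((z ^ (2 + β) : ℝ) : ℂ)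

/-! ### Riesz-Feller operators -/

/-- The constant `c¹_{γ,α}`. -/
def rfConst₁ (α γ : ℝ) : ℝ :=
  Real.Gamma (1 + α) / π * Real.sin ((α - γ) * (π / 2))

/-- The constant `c²_{γ,α}`. -/
def rfConst₂ (α γ : ℝ) : ℝ :=
  Real.Gamma (1 + α) / π * Real.sin ((α + γ) * (π / 2))

/-- The Riesz-Feller operator `D_γ^α` of order `α ∈ (0, 2)` and skewness `γ`. -/
def rieszFeller (α γ : ℝ) (u : ℝ → ℂ) (x : ℝ) : ℂ :=
  if α < 1 then
    (Real.Gamma (-α) : ℂ) *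
      ((rfConst₁ α γ : ℂ) * weylMarchaud α u x - (rfConst₂ α γ : ℂ) * weylMarchaudBar α u x)
  else if α = 1 then
    -(Real.cos (γ * (π / 2)) : ℂ) * deriv (hilbertTransform u) x +
      (Real.sin (γ * (π / 2)) : ℂ) * deriv u x
  else
    (Real.Gamma (-α) : ℂ) *
      ((rfConst₁ α γ : ℂ) * dWeylMarchaud (α - 1) u x +
        (rfConst₂ α γ : ℂ) * dWeylMarchaudBar (α - 1) u x)

/-- All derivatives, Lebesgue integrals and principal values in the definition of `rieszFeller`
exist at `x`. -/
def RieszFellerExists (α : ℝ) (u : ℝ → ℂ) (x : ℝ) : Prop :=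
  Differentiable ℝ u ∧
  (α < 1 →
    IntegrableOn (fun z : ℝ => deriv u (x - z) / ((z ^ α : ℝ) : ℂ)) (Ioi 0) ∧
    IntegrableOn (fun z : ℝ => deriv u (x + z) / ((z ^ α : ℝ) : ℂ)) (Ioi 0)) ∧
  (α = 1 → (∀ y : ℝ, HilbertExists u y) ∧ DifferentiableAt ℝ (hilbertTransform u) x) ∧
  (1 < α →
    IntegrableOn
      (fun z : ℝ => (u (x - z) - u x + deriv u x * z) / ((z ^ (1 + α) : ℝ) : ℂ)) (Ioi 0) ∧
    IntegrableOn
      (fun z : ℝ => (u (x + z) - u x - deriv u x * z) / ((z ^ (1 + α) : ℝ) : ℂ)) (Ioi 0))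

end

/-! With `w = ± I` and `n = |k|`, the Higgins function is `(1 - 2 / (1 + w x)) ^ n`, so the binomial
theorem writes it as a constant plus a combination of powers `(1 + w x) ^ (-(j + 1))`. Translating
by `± y` only changes the denominator to `a ± w y`, where `a = 1 + w x` has real part 1. Every
integral to be computed therefore reduces to one-sided integrals of such powers.

For `α ≠ 1` these are evaluated by the Beta-type formula `∫ z ^ (s - 1) (a + w z) ^ (-p) = B(s, p -
s) w ^ (-s) a ^ (s - p)` (`integral_cpow_div_pow_of_imaginary`), after one or two integrations by
parts. The two half-lines give `Γ(-α) (± w) ^ α` times the same number `gammaSum`. The operators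
thus differ only in how they weight `w ^ α` and `(-w) ^ α`, and the reflection formula turns these
weights into `-1` and `-exp(w γ π / 2)` (`fracLapConst_mul_Gamma_neg`, `Gamma_neg_mul_rfConst`).

For `α = 1` the factor `Γ(-α)` has a pole. There the Hilbert transform kills the constant and
multiplies the resolvent powers by `w` (`integral_resolventSum_sub_div`), so everything is expressed
through the first derivative. Finally `gammaSum` is, term by term, a terminating hypergeometric
series (`gammaSum_eq_ordinaryHypergeometric`). -/

/-! ### Integrability and integration by parts against powers on the half-line. -/

/-- The bound with exponent `p` is used on `(0, 1]`, the one with exponent `q` on `(1, ∞)`. -/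
theorem integrableOn_Ioi_div_rpow {φ : ℝ → ℂ} {C p q s : ℝ} (hφ : Continuous φ)
    (h₀ : ∀ z, 0 < z → ‖φ z‖ ≤ C * z ^ p) (h₁ : ∀ z, 0 < z → ‖φ z‖ ≤ C * z ^ q)
    (hp : s - 1 < p) (hq : q < s - 1) :
    IntegrableOn (fun z : ℝ => φ z / ((z ^ s : ℝ) : ℂ)) (Ioi 0) := by
  have hm : Measurable (fun z : ℝ => φ z / ((z ^ s : ℝ) : ℂ)) := by
    have := hφ.measurable
    fun_prop
  have key : ∀ r : ℝ, (∀ z, 0 < z → ‖φ z‖ ≤ C * z ^ r) → ∀ z : ℝ, 0 < z →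
      ‖φ z / ((z ^ s : ℝ) : ℂ)‖ ≤ C * z ^ (r - s) := by
    intro r hr z hz
    rw [norm_div, Complex.norm_real, Real.norm_of_nonneg (by positivity), rpow_sub hz,
      ← mul_div_assoc]
    gcongr
    exact hr z hz
  rw [← Ioc_union_Ioi_eq_Ioi zero_le_one]
  refine IntegrableOn.union ?_ ?_
  · have : IntegrableOn (fun z : ℝ => C * z ^ (p - s)) (Ioc 0 1) := by
      rw [← intervalIntegrable_iff_integrableOn_Ioc_of_le zero_le_one]
      exact (intervalIntegral.intervalIntegrable_rpow' (by linarith)).const_mul C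
    refine this.mono' hm.aestronglyMeasurable ?_
    filter_upwards [ae_restrict_mem measurableSet_Ioc] with z hz
    exact key p h₀ z hz.1
  · have : IntegrableOn (fun z : ℝ => C * z ^ (q - s)) (Ioi 1) :=
      (integrableOn_Ioi_rpow_of_lt (by linarith) one_pos).const_mul C
    refine this.mono' hm.aestronglyMeasurable ?_
    filter_upwards [ae_restrict_mem measurableSet_Ioi] with z hz
    exact key q h₁ z (one_pos.trans hz)

/-- Integration by parts with the primitive `-z ^ (-β) / β`. The boundary terms vanish at 0 because
`β < p` and at infinity because `q < β`. -/
theorem integral_Ioi_div_rpow_add_one {φ φ' : ℝ → ℂ} {C C' p q β : ℝ}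
    (hφ : ∀ z, HasDerivAt φ (φ' z) z) (hφ' : Continuous φ')
    (h₀ : ∀ z, 0 < z → ‖φ z‖ ≤ C * z ^ p) (h₁ : ∀ z, 0 < z → ‖φ z‖ ≤ C * z ^ q)
    (h₀' : ∀ z, 0 < z → ‖φ' z‖ ≤ C' * z ^ (p - 1))
    (h₁' : ∀ z, 0 < z → ‖φ' z‖ ≤ C' * z ^ (q - 1))
    (hp : β < p) (hq : q < β) (hβ : β ≠ 0) :
    ∫ z in Ioi (0 : ℝ), φ z / ((z ^ (1 + β) : ℝ) : ℂ) =
      (1 / β : ℂ) * ∫ z in Ioi (0 : ℝ), φ' z / ((z ^ β : ℝ) : ℂ) := by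
  have hc : Continuous φ := continuous_iff_continuousAt.2 fun z => (hφ z).continuousAt
  have hβ' : (β : ℂ) ≠ 0 := by exact_mod_cast hβ
  have i1 := integrableOn_Ioi_div_rpow (s := 1 + β) hc h₀ h₁ (by linarith) (by linarith)
  have i2 := integrableOn_Ioi_div_rpow (s := β) hφ' h₀' h₁' (by linarith) (by linarith)
  have hv : ∀ z ∈ Ioi (0 : ℝ), HasDerivAt (fun z : ℝ => -(1 / β : ℂ) * ((z ^ (-β) : ℝ) : ℂ))
      (((z ^ (1 + β))⁻¹ : ℝ) : ℂ) z := by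
    intro z hz
    have h1 := (Real.hasDerivAt_rpow_const (x := z) (p := -β) (Or.inl (ne_of_gt hz))).ofReal_comp
    refine (h1.const_mul (-(1 / β : ℂ))).congr_deriv ?_
    rw [← rpow_neg (le_of_lt hz), show -(1 + β) = -β - 1 by ring]
    push_cast
    field_simp
  have lim : ∀ (r : ℝ) (l : Filter ℝ), (∀ᶠ z in l, 0 < z) →
      (∀ z, 0 < z → ‖φ z‖ ≤ C * z ^ r) → Tendsto (fun z : ℝ => C * z ^ (r - β)) l (𝓝 0) →
      Tendsto (φ * fun z : ℝ => -(1 / β : ℂ) * ((z ^ (-β) : ℝ) : ℂ)) l (𝓝 0) := by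
    intro r l hl hr ht
    have : Tendsto (fun z => φ z * ((z ^ (-β) : ℝ) : ℂ)) l (𝓝 0) := by
      refine squeeze_zero_norm' ?_ ht
      filter_upwards [hl] with z hz
      rw [norm_mul, Complex.norm_real, Real.norm_of_nonneg (by positivity), sub_eq_add_neg,
        rpow_add hz, ← mul_assoc]
      gcongr
      exact hr z hz
    have h := this.const_mul (-(1 / β : ℂ))
    rw [mul_zero] at h
    exact h.congr fun z => by simp only [Pi.mul_apply]; ring
  have l0 := lim p (𝓝[>] 0) self_mem_nhdsWithin h₀ (by
    have : Tendsto (fun z : ℝ => z ^ (p - β)) (𝓝[>] 0) (𝓝 0) := by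
      have := (Real.continuousAt_rpow_const 0 (p - β) (Or.inr (by linarith))).tendsto
      rw [zero_rpow (by linarith)] at this
      exact this.mono_left nhdsWithin_le_nhds
    simpa using this.const_mul C)
  have l1 := lim q atTop (eventually_gt_atTop 0) h₁ (by
    have : Tendsto (fun z : ℝ => z ^ (q - β)) atTop (𝓝 0) := by
      simpa using tendsto_rpow_neg_atTop (y := β - q) (by linarith)
    simpa using this.const_mul C)
  have := integral_Ioi_mul_deriv_eq_deriv_mul (u := φ) (u' := φ') (a := (0 : ℝ))
    (v := fun z : ℝ => -(1 / β : ℂ) * ((z ^ (-β) : ℝ) : ℂ))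
    (v' := fun z : ℝ => (((z ^ (1 + β))⁻¹ : ℝ) : ℂ)) (fun z _ => hφ z) hv
    (by refine i1.congr_fun (fun z hz => ?_) measurableSet_Ioi; simp [div_eq_mul_inv])
    (by
      refine IntegrableOn.congr_fun (i2.const_mul (-(1 / β : ℂ))) (fun z hz => ?_) measurableSet_Ioi
      simp only [Pi.mul_apply, rpow_neg (le_of_lt hz), Complex.ofReal_inv]; ring) l0 l1
  simp only [sub_zero, zero_sub, Complex.ofReal_inv, ← div_eq_mul_inv] at this
  rw [this, ← integral_neg, ← integral_const_mul]
  refine setIntegral_congr_fun measurableSet_Ioi fun z hz => ?_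
  simp only [rpow_neg (le_of_lt hz), Complex.ofReal_inv]
  ring

/-! ### Laplace and Beta integrals with complex parameters. -/

/-- On the ball of radius `r.re / 2` around `r` real parts stay above `r.re / 2`, which gives an
integrable dominating function for the derivative. -/
theorem hasDerivAt_integral_cpow_mul_exp {a : ℝ} (ha : 0 < a) {r : ℂ} (hr : 0 < r.re) :
    HasDerivAt (fun r : ℂ => ∫ t in Ioi (0 : ℝ), (t : ℂ) ^ ((a : ℂ) - 1) * Complex.exp (-(r * t)))
      (∫ t in Ioi (0 : ℝ), (t : ℂ) ^ ((a : ℂ) - 1) * (Complex.exp (-(r * t)) * -t)) r := by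
  have hn : ∀ (v : ℂ) (t : ℝ), 0 < t → ‖(t : ℂ) ^ ((a : ℂ) - 1) * Complex.exp (-(v * t))‖ =
      t ^ (a - 1) * Real.exp (-(v.re * t)) := by
    intro v t ht
    rw [norm_mul, Complex.norm_cpow_eq_rpow_re_of_pos ht, Complex.norm_exp]
    simp
  have hint : ∀ (c b : ℝ), 0 < c → 0 < b →
      IntegrableOn (fun t : ℝ => t ^ (c - 1) * Real.exp (-(b * t))) (Ioi 0) := fun c b hc hb =>
    .of_integral_ne_zero (by
      rw [integral_rpow_mul_exp_neg_mul_Ioi hc hb]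
      have := Real.Gamma_pos_of_pos hc
      positivity)
  have hm : ∀ v : ℂ, AEStronglyMeasurable
      (fun t : ℝ => (t : ℂ) ^ ((a : ℂ) - 1) * Complex.exp (-(v * t)))
      (volume.restrict (Ioi 0)) := fun v => by
    refine Measurable.aestronglyMeasurable ?_
    fun_prop
  refine (hasDerivAt_integral_of_dominated_loc_of_deriv_le
    (F' := fun (r : ℂ) (t : ℝ) => (t : ℂ) ^ ((a : ℂ) - 1) * (Complex.exp (-(r * t)) * -t))
    (bound := fun t : ℝ => t ^ ((a + 1) - 1) * Real.exp (-(r.re / 2 * t)))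
    (Metric.ball_mem_nhds r (half_pos hr)) (Eventually.of_forall hm) ?_ ?_ ?_
    (hint _ _ (by linarith) (half_pos hr)) ?_).2
  · refine (hint a r.re ha hr).mono' (hm r) ?_
    filter_upwards [ae_restrict_mem measurableSet_Ioi] with t ht
    exact (hn r t ht).le
  · refine Measurable.aestronglyMeasurable ?_
    fun_prop
  · filter_upwards [ae_restrict_mem measurableSet_Ioi] with t ht v hv
    have ht : 0 < t := ht
    have h1 : r.re / 2 ≤ v.re := by
      have h2 := Complex.abs_re_le_norm (v - r)
      rw [Metric.mem_ball, dist_eq_norm] at hv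
      have := (abs_le.1 (h2.trans hv.le)).1
      rw [Complex.sub_re] at this
      linarith
    rw [← mul_assoc, norm_mul, hn v t ht, norm_neg, Complex.norm_real, Real.norm_of_nonneg ht.le,
      show a + 1 - 1 = (a - 1) + 1 by ring, rpow_add_one ht.ne', mul_right_comm]
    gcongr
  · filter_upwards [ae_restrict_mem measurableSet_Ioi] with t ht v hv
    have h1 : HasDerivAt (fun v : ℂ => -(v * t)) (-(t : ℂ)) v := by
      simpa using ((hasDerivAt_id v).mul_const (t : ℂ)).fun_neg
    exact h1.cexp.const_mul _

/-- Analytic continuation: both sides are analytic on the right half-plane and agree at real points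
accumulating at 1. -/
theorem integral_cpow_mul_exp_neg_mul_Ioi_of_re_pos {a : ℝ} (ha : 0 < a) {r : ℂ} (hr : 0 < r.re) :
    ∫ t in Ioi (0 : ℝ), (t : ℂ) ^ ((a : ℂ) - 1) * Complex.exp (-(r * t)) =
      r ^ (-a : ℂ) * Complex.Gamma a := by
  have hU : IsOpen {r : ℂ | 0 < r.re} := isOpen_lt continuous_const Complex.continuous_re
  have hf : AnalyticOnNhd ℂ (fun r : ℂ => ∫ t in Ioi (0 : ℝ), (t : ℂ) ^ ((a : ℂ) - 1) *
      Complex.exp (-(r * t))) {r : ℂ | 0 < r.re} :=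
    DifferentiableOn.analyticOnNhd (fun v hv =>
      (hasDerivAt_integral_cpow_mul_exp ha hv).differentiableAt.differentiableWithinAt) hU
  have hg : AnalyticOnNhd ℂ (fun r : ℂ => r ^ (-a : ℂ) * Complex.Gamma a) {r : ℂ | 0 < r.re} :=
    DifferentiableOn.analyticOnNhd (fun v hv =>
      ((differentiableAt_id.cpow_const (Or.inl hv)).mul_const _).differentiableWithinAt) hU
  refine hf.eqOn_of_preconnected_of_frequently_eq hg
    (convex_halfSpace_re_gt 0).isPreconnected (z₀ := 1) (by simp) ?_ hr
  have ht : Tendsto (fun x : ℝ => (x : ℂ)) (𝓝[≠] 1) (𝓝[≠] 1) := by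
    refine tendsto_nhdsWithin_of_tendsto_nhds_of_eventually_within _ ?_ ?_
    · exact (Complex.continuous_ofReal.tendsto' 1 1 (by simp)).mono_left nhdsWithin_le_nhds
    · filter_upwards [self_mem_nhdsWithin] with x hx
      simpa using hx
  refine ht.frequently (Eventually.frequently ?_)
  filter_upwards [nhdsWithin_le_nhds (lt_mem_nhds one_pos)] with x hx
  rw [Complex.integral_cpow_mul_exp_neg_mul_Ioi (by simpa using ha) hx, one_div,
    Complex.inv_cpow _ _ (by rw [Complex.arg_ofReal_of_nonneg hx.le]; exact pi_pos.ne),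
    ← Complex.cpow_neg]

/-- This justifies Fubini below. Integrating the norm in the first variable leaves `t ^ (p - s - 1)
* exp (-b.re * t)` up to a constant, integrable at 0 because `s < p`. -/
theorem integrable_laplace_kernel {s : ℝ} {p : ℕ} {b w : ℂ} (hs : 0 < s) (hsp : s < p)
    (hb : 0 < b.re) (hw : 0 < w.re) :
    Integrable (fun q : ℝ × ℝ => (q.1 : ℂ) ^ ((s : ℂ) - 1) *
      ((q.2 : ℂ) ^ ((p : ℂ) - 1) * Complex.exp (-((b + w * q.1) * q.2))))
      ((volume.restrict (Ioi 0)).prod (volume.restrict (Ioi 0))) := by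
  have hm : Measurable (fun q : ℝ × ℝ => (q.1 : ℂ) ^ ((s : ℂ) - 1) *
      ((q.2 : ℂ) ^ ((p : ℂ) - 1) * Complex.exp (-((b + w * q.1) * q.2)))) := by fun_prop
  have hn : ∀ z t : ℝ, 0 < z → 0 < t → ‖(z : ℂ) ^ ((s : ℂ) - 1) *
      ((t : ℂ) ^ ((p : ℂ) - 1) * Complex.exp (-((b + w * z) * t)))‖ =
      (t ^ ((p : ℝ) - 1) * Real.exp (-(b.re * t))) *
        (z ^ (s - 1) * Real.exp (-((w.re * t) * z))) := by
    intro z t hz ht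
    rw [norm_mul, norm_mul, Complex.norm_cpow_eq_rpow_re_of_pos hz,
      Complex.norm_cpow_eq_rpow_re_of_pos ht, Complex.norm_exp]
    have : (-((b + w * z) * t)).re = -(b.re * t) + -(w.re * t * z) := by
      simp; ring
    rw [this, Real.exp_add]
    simp
    ring
  have hI : ∀ t : ℝ, 0 < t → IntegrableOn (fun z : ℝ => z ^ (s - 1) *
      Real.exp (-((w.re * t) * z))) (Ioi 0) := fun t ht =>
    .of_integral_ne_zero (by
      rw [integral_rpow_mul_exp_neg_mul_Ioi hs (by positivity)]
      have := Real.Gamma_pos_of_pos hs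
      positivity)
  rw [integrable_prod_iff' hm.aestronglyMeasurable]
  constructor
  · filter_upwards [ae_restrict_mem measurableSet_Ioi] with t ht
    refine ((hI t ht).const_mul (t ^ ((p : ℝ) - 1) * Real.exp (-(b.re * t)))).mono'
      (hm.comp measurable_prodMk_right).aestronglyMeasurable ?_
    filter_upwards [ae_restrict_mem measurableSet_Ioi] with z hz
    exact (hn z t hz ht).le
  · have h : IntegrableOn (fun t : ℝ => (w.re⁻¹ ^ s * Real.Gamma s) *
        (t ^ (((p : ℝ) - s) - 1) * Real.exp (-(b.re * t)))) (Ioi 0) :=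
      Integrable.const_mul (.of_integral_ne_zero (by
        rw [integral_rpow_mul_exp_neg_mul_Ioi (sub_pos.2 hsp) hb]
        have := Real.Gamma_pos_of_pos (sub_pos.2 hsp)
        positivity)) _
    refine IntegrableOn.congr_fun h (fun t ht => ?_) measurableSet_Ioi
    have ht : 0 < t := ht
    dsimp only
    rw [setIntegral_congr_fun measurableSet_Ioi fun z hz => hn z t hz ht, integral_const_mul,
      integral_rpow_mul_exp_neg_mul_Ioi hs (by positivity), one_div, mul_inv,
      Real.mul_rpow (by positivity) (by positivity), Real.inv_rpow ht.le,
      show (p : ℝ) - s - 1 = (p - 1) + -s by ring, rpow_add ht, rpow_neg ht.le]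
    ring

theorem Complex.mul_cpow_of_arg_add_mem {x y : ℂ} (hx : x ≠ 0) (hy : y ≠ 0)
    (h : x.arg + y.arg ∈ Ioc (-π) π) (s : ℂ) : (x * y) ^ s = x ^ s * y ^ s := by
  rw [Complex.cpow_def_of_ne_zero (mul_ne_zero hx hy), Complex.cpow_def_of_ne_zero hx,
    Complex.cpow_def_of_ne_zero hy, Complex.log_mul hx hy h, ← Complex.exp_add, add_mul]

/-- One double integral computed in two orders: integrating `t` first produces `Γ(p) (b + w z) ^
(-p)`, while integrating `z` first produces `Γ(s) (w t) ^ (-s)` and leaves a Gamma integral of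
parameter `p - s`. -/
theorem integral_cpow_div_pow_of_re_pos {s : ℝ} {p : ℕ} {b w : ℂ} (hs : 0 < s) (hsp : s < p)
    (hb : 0 < b.re) (hw : 0 < w.re) :
    ∫ z in Ioi (0 : ℝ), (z : ℂ) ^ ((s : ℂ) - 1) * ((b + w * z)⁻¹) ^ p =
      Complex.Gamma s * Complex.Gamma (p - s) / Complex.Gamma p *
        (w ^ (-s : ℂ) * b ^ ((s : ℂ) - p)) := by
  have hp : (0 : ℝ) < p := hs.trans hsp
  have hGp : Complex.Gamma p ≠ 0 := Complex.Gamma_ne_zero_of_re_pos (by simpa using hp)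
  have swap := integral_integral_swap (f := fun z t : ℝ => (z : ℂ) ^ ((s : ℂ) - 1) *
    ((t : ℂ) ^ ((p : ℂ) - 1) * Complex.exp (-((b + w * z) * t)))) (integrable_laplace_kernel hs hsp hb hw)
  have hps := integral_cpow_mul_exp_neg_mul_Ioi_of_re_pos (sub_pos.2 hsp) hb
  rw [Complex.ofReal_sub, Complex.ofReal_natCast, neg_sub] at hps
  have lhs : ∀ z ∈ Ioi (0 : ℝ), ∫ t in Ioi (0 : ℝ), (z : ℂ) ^ ((s : ℂ) - 1) *
      ((t : ℂ) ^ ((p : ℂ) - 1) * Complex.exp (-((b + w * z) * t))) =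
      Complex.Gamma p * ((z : ℂ) ^ ((s : ℂ) - 1) * ((b + w * z)⁻¹) ^ p) := by
    intro z hz
    have hz : 0 < z := hz
    have h := integral_cpow_mul_exp_neg_mul_Ioi_of_re_pos hp (r := b + w * z)
      (by simp; positivity)
    rw [Complex.ofReal_natCast] at h
    rw [integral_const_mul, h, Complex.cpow_neg, Complex.cpow_natCast, inv_pow]
    ring
  have rhs : ∀ t ∈ Ioi (0 : ℝ), ∫ z in Ioi (0 : ℝ), (z : ℂ) ^ ((s : ℂ) - 1) *
      ((t : ℂ) ^ ((p : ℂ) - 1) * Complex.exp (-((b + w * z) * t))) =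
      (Complex.Gamma s * w ^ (-s : ℂ)) *
        ((t : ℂ) ^ (((p : ℂ) - s) - 1) * Complex.exp (-(b * t))) := by
    intro t ht
    have ht : 0 < t := ht
    have ht' : (t : ℂ) ≠ 0 := by exact_mod_cast ht.ne'
    have e : ∀ z : ℝ, (z : ℂ) ^ ((s : ℂ) - 1) *
        ((t : ℂ) ^ ((p : ℂ) - 1) * Complex.exp (-((b + w * z) * t))) =
        ((t : ℂ) ^ ((p : ℂ) - 1) * Complex.exp (-(b * t))) *
          ((z : ℂ) ^ ((s : ℂ) - 1) * Complex.exp (-((w * t) * z))) := by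
      intro z
      rw [show -((b + w * z) * t) = -(b * t) + -(w * t * z) by ring, Complex.exp_add]
      ring
    have hwt : 0 < (w * (t : ℂ)).re := by simp; positivity
    simp_rw [e]
    rw [integral_const_mul, integral_cpow_mul_exp_neg_mul_Ioi_of_re_pos hs hwt,
      Complex.mul_cpow_of_arg_add_mem (by rintro rfl; simp at hw) ht'
        (by rw [Complex.arg_ofReal_of_nonneg ht.le, add_zero]; exact Complex.arg_mem_Ioc w),
      show (p : ℂ) - s - 1 = (p - 1) + -s by ring, Complex.cpow_add _ _ ht']
    ring
  rw [setIntegral_congr_fun measurableSet_Ioi lhs, setIntegral_congr_fun measurableSet_Ioi rhs,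
    integral_const_mul, integral_const_mul, hps] at swap
  rw [div_mul_eq_mul_div, eq_div_iff hGp, mul_comm, swap]
  ring

/-- For imaginary `w` the double integral lacks exponential decay in `z`. Both sides are homogeneous
of degree `-p` in `(a, w)`, so multiplying both by a suitable `v` moves the pair into the open right
half-plane. -/
theorem integral_cpow_div_pow_of_imaginary {s : ℝ} {p : ℕ} {a w : ℂ} (hs : 0 < s) (hsp : s < p)
    (ha : 0 < a.re) (hw : w.re = 0) (hw₀ : w ≠ 0) :
    ∫ z in Ioi (0 : ℝ), (z : ℂ) ^ ((s : ℂ) - 1) * ((a + w * z)⁻¹) ^ p =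
      Complex.Gamma s * Complex.Gamma (p - s) / Complex.Gamma p *
        (w ^ (-s : ℂ) * a ^ ((s : ℂ) - p)) := by
  have hw' : w.im ≠ 0 := fun h => hw₀ (Complex.ext hw h)
  -- Chosen so that `(v * a).re = a.re + δ * (w.im * a.im) ≥ δ`.
  set δ : ℝ := a.re / (|w.im * a.im| + 1) with hδ
  have hδ₀ : 0 < δ := by positivity
  set v : ℂ := 1 - w * δ with hv
  have hvre : 0 < v.re := by simp [hv, hw]
  have hv₀ : v ≠ 0 := by intro h; simp [h] at hvre
  have ha₀ : a ≠ 0 := by intro h; simp [h] at ha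
  have hva : 0 < (v * a).re := by
    have h1 : (v * a).re = a.re + δ * (w.im * a.im) := by simp [hv, hw]; ring
    have h2 : δ * (|w.im * a.im| + 1) = a.re := by rw [hδ]; field_simp
    have h3 := neg_abs_le (w.im * a.im)
    rw [h1]
    nlinarith
  have hvw : 0 < (v * w).re := by
    have h1 : (v * w).re = δ * (w.im * w.im) := by simp [hv, hw]; ring
    rw [h1]
    exact mul_pos hδ₀ (mul_self_pos.2 hw')
  have argv := abs_lt.1 (Complex.abs_arg_lt_pi_div_two_iff.2 (Or.inl hvre))
  have arga := abs_lt.1 (Complex.abs_arg_lt_pi_div_two_iff.2 (Or.inl ha))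
  have argw := abs_le.1 (Complex.abs_arg_le_pi_div_two_iff.2 hw.ge)
  have key := integral_cpow_div_pow_of_re_pos hs hsp hva hvw
  have e : ∀ z : ℝ, (z : ℂ) ^ ((s : ℂ) - 1) * ((v * a + v * w * z)⁻¹) ^ p =
      (v⁻¹) ^ p * ((z : ℂ) ^ ((s : ℂ) - 1) * ((a + w * z)⁻¹) ^ p) := by
    intro z
    rw [show v * a + v * w * z = v * (a + w * z) by ring, mul_inv, mul_pow]
    ring
  simp_rw [e] at key
  -- Since `|arg v| < π / 2`, `|arg a| < π / 2` and `|arg w| ≤ π / 2`, the principal powers of `v *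
  -- w` and `v * a` factor.
  rw [integral_const_mul,
    Complex.mul_cpow_of_arg_add_mem hv₀ hw₀ ⟨by linarith, by linarith⟩,
    Complex.mul_cpow_of_arg_add_mem hv₀ ha₀ ⟨by linarith, by linarith⟩,
    Complex.cpow_sub _ _ hv₀, Complex.cpow_neg, Complex.cpow_natCast] at key
  have hvs : v ^ (s : ℂ) ≠ 0 := by simp [Complex.cpow_eq_zero_iff, hv₀]
  have hvp : v ^ p ≠ 0 := pow_ne_zero _ hv₀
  rw [← mul_right_inj' (pow_ne_zero p (inv_ne_zero hv₀)), key, inv_pow]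
  field_simp

/-! ### Combinations of resolvent powers: bounds, derivatives and weighted integrals. -/

/-- The rational function `∑ j < n, q j (a + w z) ^ (-(j + m))`. -/
noncomputable def resolventSum (q : ℕ → ℂ) (n m : ℕ) (a w : ℂ) (z : ℝ) : ℂ :=
  ∑ j ∈ Finset.range n, q j * ((a + w * z)⁻¹) ^ (j + m)

/-- The sum `∑ j < n, q j Γ(j + 1 + α) / Γ(j + 1) a ^ (-(j + 1 + α))`. -/
noncomputable def gammaSum (q : ℕ → ℂ) (n : ℕ) (α : ℝ) (a : ℂ) : ℂ :=
  ∑ j ∈ Finset.range n, q j * (Complex.Gamma (j + 1 + α) / Complex.Gamma (j + 1)) *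
    a ^ (-(j + 1 + α) : ℂ)

section
variable {a w : ℂ}

theorem one_le_norm_add_mul (ha : a.re = 1) (hw : w.re = 0) (z : ℝ) : 1 ≤ ‖a + w * z‖ := by
  refine le_trans ?_ (Complex.abs_re_le_norm _)
  simp [ha, hw]

theorem add_mul_ne_zero (ha : a.re = 1) (hw : w.re = 0) (z : ℝ) : a + w * z ≠ 0 := by
  intro h
  have := one_le_norm_add_mul ha hw z
  simp [h] at this
  linarith

theorem norm_inv_add_mul_le_one (ha : a.re = 1) (hw : w.re = 0) (z : ℝ) :
    ‖(a + w * z)⁻¹‖ ≤ 1 := by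
  rw [norm_inv]
  exact inv_le_one_of_one_le₀ (one_le_norm_add_mul ha hw z)

theorem norm_inv_add_mul_le (ha : a.re = 1) (hw : w.re = 0) (hw₁ : ‖w‖ = 1) {z : ℝ} (hz : 0 < z) :
    ‖(a + w * z)⁻¹‖ ≤ (1 + ‖a‖) * z ^ (-1 : ℝ) := by
  have h0 := add_mul_ne_zero ha hw z
  -- The resolvent identity `w z / (a + w z) = 1 - a / (a + w z)` turns boundedness of the inverse
  -- into decay of order `1 / z`.
  have h1 : z * ‖(a + w * z)⁻¹‖ = ‖1 - a * (a + w * z)⁻¹‖ := by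
    rw [show 1 - a * (a + w * z)⁻¹ = w * z * (a + w * z)⁻¹ by field_simp; ring, norm_mul, norm_mul,
      hw₁, one_mul, Complex.norm_real, Real.norm_of_nonneg hz.le]
  have h2 : ‖1 - a * (a + w * z)⁻¹‖ ≤ 1 + ‖a‖ := by
    refine (norm_sub_le _ _).trans ?_
    rw [norm_one, norm_mul]
    have := mul_le_mul_of_nonneg_left (norm_inv_add_mul_le_one ha hw z) (norm_nonneg a)
    linarith
  rw [rpow_neg_one, ← div_eq_mul_inv, le_div_iff₀ hz]
  linarith

theorem norm_resolventSum_le (q : ℕ → ℂ) (n m : ℕ) (ha : a.re = 1) (hw : w.re = 0) (z : ℝ) :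
    ‖resolventSum q n m a w z‖ ≤ ∑ j ∈ Finset.range n, ‖q j‖ := by
  refine (norm_sum_le _ _).trans (Finset.sum_le_sum fun j _ => ?_)
  rw [norm_mul, norm_pow]
  exact mul_le_of_le_one_right (norm_nonneg _)
    (pow_le_one₀ (norm_nonneg _) (norm_inv_add_mul_le_one ha hw z))

theorem norm_resolventSum_le_mul_rpow (q : ℕ → ℂ) (n : ℕ) {m : ℕ} (hm : 1 ≤ m) (ha : a.re = 1)
    (hw : w.re = 0) (hw₁ : ‖w‖ = 1) {z : ℝ} (hz : 0 < z) :
    ‖resolventSum q n m a w z‖ ≤ (∑ j ∈ Finset.range n, ‖q j‖) * (1 + ‖a‖) * z ^ (-1 : ℝ) := by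
  rw [mul_assoc, Finset.sum_mul]
  refine (norm_sum_le _ _).trans (Finset.sum_le_sum fun j _ => ?_)
  rw [norm_mul, norm_pow]
  refine mul_le_mul_of_nonneg_left ?_ (norm_nonneg _)
  obtain ⟨r, hr⟩ := Nat.exists_eq_add_of_le (show 1 ≤ j + m by lia)
  rw [hr, pow_add, pow_one]
  exact (mul_le_of_le_one_right (norm_nonneg _)
    (pow_le_one₀ (norm_nonneg _) (norm_inv_add_mul_le_one ha hw z))).trans
      (norm_inv_add_mul_le ha hw hw₁ hz)

/-- Differentiation keeps the shape of these sums and raises `m` by one, so the same bounds and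
integral formula apply to all derivatives. -/
theorem hasDerivAt_resolventSum (q : ℕ → ℂ) (n m : ℕ) (ha : a.re = 1) (hw : w.re = 0) (z : ℝ) :
    HasDerivAt (resolventSum q n m a w)
      (resolventSum (fun j => -w * (j + m : ℕ) * q j) n (m + 1) a w z) z := by
  have h0 := add_mul_ne_zero ha hw z
  have h1 : HasDerivAt (fun z : ℝ => a + w * z) w z := by
    simpa using ((Complex.ofRealCLM.hasDerivAt (x := z)).const_mul w).const_add a
  refine HasDerivAt.fun_sum fun j _ => ?_
  refine (((h1.fun_inv h0).fun_pow (j + m)).const_mul (q j)).congr_deriv ?_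
  -- The power rule carries the truncated exponent `j + m - 1`, so exponent 0 is separated.
  rcases Nat.eq_zero_or_pos (j + m) with h | h
  · simp [h]
  · obtain ⟨r, hr⟩ := Nat.exists_eq_add_of_le' (show 1 ≤ j + m from h)
    rw [← add_assoc]
    simp only [hr, Nat.add_sub_cancel, pow_succ]
    field_simp

theorem continuous_resolventSum (q : ℕ → ℂ) (n m : ℕ) (ha : a.re = 1) (hw : w.re = 0) :
    Continuous (resolventSum q n m a w) :=
  continuous_iff_continuousAt.2 fun z => (hasDerivAt_resolventSum q n m ha hw z).continuousAt

theorem resolventSum_const_mul (q : ℕ → ℂ) (c : ℂ) (n m : ℕ) (z : ℝ) :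
    resolventSum (fun j => c * q j) n m a w z = c * resolventSum q n m a w z := by
  simp [resolventSum, Finset.mul_sum, mul_assoc]

/-- The Beta integral termwise, with `s = 1 - β` and `p = j + m`. Boundedness near 0 and decay `1 /
z` at infinity are enough for `0 < β < 1`. -/
theorem integral_resolventSum_div_rpow (q : ℕ → ℂ) (n : ℕ) {m : ℕ} (hm : 1 ≤ m) {β : ℝ}
    (hβ₀ : 0 < β) (hβ₁ : β < 1) (ha : a.re = 1) (hw : w.re = 0) (hw₁ : ‖w‖ = 1) :
    IntegrableOn (fun z : ℝ => resolventSum q n m a w z / ((z ^ β : ℝ) : ℂ)) (Ioi 0) ∧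
    ∫ z in Ioi (0 : ℝ), resolventSum q n m a w z / ((z ^ β : ℝ) : ℂ) =
      Complex.Gamma (1 - β) * w ^ ((β : ℂ) - 1) * ∑ j ∈ Finset.range n,
        q j * (Complex.Gamma (j + m - 1 + β) / Complex.Gamma (j + m)) *
          a ^ (-(j + m - 1 + β) : ℂ) := by
  have hint : ∀ (q : ℕ → ℂ) (n m : ℕ), 1 ≤ m →
      IntegrableOn (fun z : ℝ => resolventSum q n m a w z / ((z ^ β : ℝ) : ℂ)) (Ioi 0) := by
    intro q n m hm
    refine integrableOn_Ioi_div_rpow (C := (∑ j ∈ Finset.range n, ‖q j‖) * (1 + ‖a‖))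
      (p := 0) (q := -1) (continuous_resolventSum q n m ha hw) (fun z hz => ?_)
      (fun z hz => norm_resolventSum_le_mul_rpow q n hm ha hw hw₁ hz) (by linarith) (by linarith)
    rw [rpow_zero, mul_one]
    refine (norm_resolventSum_le q n m ha hw z).trans (le_mul_of_one_le_right ?_ ?_)
    · positivity
    · linarith [norm_nonneg a]
  refine ⟨hint q n m hm, ?_⟩
  have hw₀ : w ≠ 0 := by rintro rfl; simp at hw₁
  have hone : ∀ p : ℕ, 1 ≤ p →
      IntegrableOn (fun z : ℝ => ((a + w * z)⁻¹) ^ p / ((z ^ β : ℝ) : ℂ)) (Ioi 0) := fun p hp => by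
    simpa [resolventSum] using hint (fun _ => 1) 1 p hp
  have e : ∀ z : ℝ, resolventSum q n m a w z / ((z ^ β : ℝ) : ℂ) =
      ∑ j ∈ Finset.range n, q j * (((a + w * z)⁻¹) ^ (j + m) / ((z ^ β : ℝ) : ℂ)) := by
    intro z
    simp [resolventSum, Finset.sum_div, mul_div_assoc]
  simp_rw [e]
  rw [integral_finsetSum _ fun j _ => (hone (j + m) (by lia)).const_mul (q j), Finset.mul_sum]
  refine Finset.sum_congr rfl fun j _ => ?_
  have hjm : (1 : ℝ) ≤ (j + m : ℕ) := by exact_mod_cast (show 1 ≤ j + m by lia)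
  have key := integral_cpow_div_pow_of_imaginary (s := 1 - β) (p := j + m) (a := a) (w := w)
    (by linarith) (by linarith) (by linarith) hw hw₀
  rw [integral_const_mul, setIntegral_congr_fun (g := fun z : ℝ =>
    (z : ℂ) ^ (((1 - β : ℝ) : ℂ) - 1) * ((a + w * z)⁻¹) ^ (j + m)) measurableSet_Ioi, key]
  · push_cast
    rw [show ((j : ℂ) + m - (1 - β)) = j + m - 1 + β by ring,
      show (-(1 - β) : ℂ) = β - 1 by ring,
      show ((1 : ℂ) - β - (j + m)) = -(j + m - 1 + β) by ring]
    ring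
  · intro z hz
    have hz : 0 < z := hz
    dsimp only
    rw [Complex.ofReal_cpow hz.le]
    push_cast
    rw [show (1 : ℂ) - β - 1 = -β by ring, Complex.cpow_neg]
    ring

end

theorem norm_sub_le_of_hasDerivAt_of_norm_le {φ φ' : ℝ → ℂ} {M z : ℝ} (hz : 0 ≤ z)
    (hφ : ∀ t, HasDerivAt φ (φ' t) t) (hM : ∀ t, 0 ≤ t → t ≤ z → ‖φ' t‖ ≤ M) :
    ‖φ z - φ 0‖ ≤ M * z := by
  simpa using norm_image_sub_le_of_norm_deriv_le_segment' (a := 0) (b := z)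
    (fun t _ => (hφ t).hasDerivWithinAt) (fun t ht => hM t ht.1 ht.2.le) z ⟨hz, le_rfl⟩

section
variable {a w : ℂ}

/-- One integration by parts lowers the weight from `1 + α` to `α`. The factor `-w (j + 1)` of the
derivative is absorbed by `Γ(1 - α) = -α Γ(-α)`, `Γ(j + 2) = (j + 1) Γ(j + 1)` and `w ^ (α - 1)`. -/
theorem integral_resolventSum_sub_div_rpow (q : ℕ → ℂ) (n : ℕ) {α : ℝ}
    (hα₀ : 0 < α) (hα₁ : α < 1) (ha : a.re = 1) (hw : w.re = 0) (hw₁ : ‖w‖ = 1) :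
    IntegrableOn (fun z : ℝ => resolventSum (fun j => -w * (j + 1 : ℕ) * q j) n 2 a w z /
      ((z ^ α : ℝ) : ℂ)) (Ioi 0) ∧
    ∫ z in Ioi (0 : ℝ), resolventSum (fun j => -w * (j + 1 : ℕ) * q j) n 2 a w z /
      ((z ^ α : ℝ) : ℂ) = α * (Complex.Gamma (-α) * w ^ (α : ℂ) * gammaSum q n α a) ∧
    IntegrableOn (fun z : ℝ => (resolventSum q n 1 a w z - resolventSum q n 1 a w 0) /
      ((z ^ (1 + α) : ℝ) : ℂ)) (Ioi 0) ∧
    ∫ z in Ioi (0 : ℝ), (resolventSum q n 1 a w z - resolventSum q n 1 a w 0) /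
      ((z ^ (1 + α) : ℝ) : ℂ) = Complex.Gamma (-α) * w ^ (α : ℂ) * gammaSum q n α a := by
  set q' : ℕ → ℂ := fun j => -w * (j + 1 : ℕ) * q j with hq'
  have hw₀ : w ≠ 0 := by rintro rfl; simp at hw₁
  have hα : (α : ℂ) ≠ 0 := by exact_mod_cast hα₀.ne'
  set M := ∑ j ∈ Finset.range n, ‖q j‖ with hM
  set M' := ∑ j ∈ Finset.range n, ‖q' j‖ with hM'
  have hM₀ : 0 ≤ M := by positivity
  have hM₀' : 0 ≤ M' := by positivity
  have hf : ∀ z, HasDerivAt (resolventSum q n 1 a w) (resolventSum q' n 2 a w z) z :=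
    hasDerivAt_resolventSum q n 1 ha hw
  have hφ : ∀ z, HasDerivAt (fun z => resolventSum q n 1 a w z - resolventSum q n 1 a w 0)
      (resolventSum q' n 2 a w z) z := fun z => (hf z).sub_const _
  have hb : ∀ z, ‖resolventSum q n 1 a w z‖ ≤ M := norm_resolventSum_le q n 1 ha hw
  have hb' : ∀ z, ‖resolventSum q' n 2 a w z‖ ≤ M' := norm_resolventSum_le q' n 2 ha hw
  have b0 : ∀ z, 0 < z → ‖resolventSum q n 1 a w z - resolventSum q n 1 a w 0‖ ≤
      (M' + 2 * M) * z ^ (1 : ℝ) := fun z hz => by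
    have := norm_sub_le_of_hasDerivAt_of_norm_le hz.le hf fun t _ _ => hb' t
    rw [rpow_one]
    nlinarith
  have b1 : ∀ z, 0 < z → ‖resolventSum q n 1 a w z - resolventSum q n 1 a w 0‖ ≤
      (M' + 2 * M) * z ^ (0 : ℝ) := fun z hz => by
    have := norm_sub_le (resolventSum q n 1 a w z) (resolventSum q n 1 a w 0)
    rw [rpow_zero]
    linarith [hb z, hb 0]
  have b0' : ∀ z, 0 < z → ‖resolventSum q' n 2 a w z‖ ≤
      M' * (1 + ‖a‖) * z ^ ((1 : ℝ) - 1) := fun z _ => by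
    rw [sub_self, rpow_zero]
    nlinarith [hb' z, norm_nonneg a]
  have b1' : ∀ z, 0 < z → ‖resolventSum q' n 2 a w z‖ ≤
      M' * (1 + ‖a‖) * z ^ ((0 : ℝ) - 1) := fun z hz => by
    rw [zero_sub]
    exact norm_resolventSum_le_mul_rpow q' n one_le_two ha hw hw₁ hz
  obtain ⟨i1, i2⟩ := integral_resolventSum_div_rpow q' n one_le_two hα₀ hα₁ ha hw hw₁
  have i3 : ∫ z in Ioi (0 : ℝ), resolventSum q' n 2 a w z / ((z ^ α : ℝ) : ℂ) =
      α * (Complex.Gamma (-α) * w ^ (α : ℂ) * gammaSum q n α a) := by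
    rw [i2, show (1 : ℂ) - α = -α + 1 by ring, Complex.Gamma_add_one _ (neg_ne_zero.2 hα),
      Complex.cpow_sub _ _ hw₀, Complex.cpow_one, gammaSum, Finset.mul_sum, Finset.mul_sum,
      Finset.mul_sum]
    refine Finset.sum_congr rfl fun j _ => ?_
    have hj : (j : ℂ) + 1 ≠ 0 := by exact_mod_cast j.succ_ne_zero
    push_cast [hq']
    rw [show (j : ℂ) + 2 - 1 + α = j + 1 + α by ring, show (j : ℂ) + 2 = (j + 1) + 1 by ring,
      Complex.Gamma_add_one _ hj]
    field_simp
  refine ⟨i1, i3, integrableOn_Ioi_div_rpow ((continuous_resolventSum q n 1 ha hw).sub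
    continuous_const) b0 b1 (by linarith) (by linarith), ?_⟩
  rw [integral_Ioi_div_rpow_add_one hφ (continuous_resolventSum q' n 2 ha hw) b0 b1 b0' b1'
    hα₁ hα₀ hα₀.ne', i3]
  field_simp

/-- Two integrations by parts reach the exponent `α - 1 ∈ (0, 1)`; subtracting the linear Taylor
term makes the boundary terms at 0 vanish. The value is the same expression as for `α < 1`. -/
theorem integral_resolventSum_taylor_div_rpow (q : ℕ → ℂ) (n : ℕ) {α : ℝ}
    (hα₁ : 1 < α) (hα₂ : α < 2) (ha : a.re = 1) (hw : w.re = 0) (hw₁ : ‖w‖ = 1) :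
    IntegrableOn (fun z : ℝ => (resolventSum q n 1 a w z - resolventSum q n 1 a w 0 -
      resolventSum (fun j => -w * (j + 1 : ℕ) * q j) n 2 a w 0 * z) /
      ((z ^ (1 + α) : ℝ) : ℂ)) (Ioi 0) ∧
    ∫ z in Ioi (0 : ℝ), (resolventSum q n 1 a w z - resolventSum q n 1 a w 0 -
      resolventSum (fun j => -w * (j + 1 : ℕ) * q j) n 2 a w 0 * z) /
      ((z ^ (1 + α) : ℝ) : ℂ) = Complex.Gamma (-α) * w ^ (α : ℂ) * gammaSum q n α a := by
  set q' : ℕ → ℂ := fun j => -w * (j + 1 : ℕ) * q j with hq'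
  set q'' : ℕ → ℂ := fun j => -w * (j + 2 : ℕ) * q' j with hq''
  have hw₀ : w ≠ 0 := by rintro rfl; simp at hw₁
  have hα : (α : ℂ) ≠ 0 := by exact_mod_cast (show α ≠ 0 by linarith)
  have hα' : (α : ℂ) - 1 ≠ 0 := by exact_mod_cast (show α - 1 ≠ 0 by linarith)
  set M' := ∑ j ∈ Finset.range n, ‖q' j‖ with hM'
  set M'' := ∑ j ∈ Finset.range n, ‖q'' j‖ with hM''
  have hM₀' : 0 ≤ M' := by positivity
  have hM₀'' : 0 ≤ M'' := by positivity
  have hf : ∀ z, HasDerivAt (resolventSum q n 1 a w) (resolventSum q' n 2 a w z) z :=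
    hasDerivAt_resolventSum q n 1 ha hw
  have hf' : ∀ z, HasDerivAt (resolventSum q' n 2 a w) (resolventSum q'' n 3 a w z) z :=
    hasDerivAt_resolventSum q' n 2 ha hw
  have hψ : ∀ z, HasDerivAt (fun z => resolventSum q' n 2 a w z - resolventSum q' n 2 a w 0)
      (resolventSum q'' n 3 a w z) z := fun z => (hf' z).sub_const _
  have hφ : ∀ z : ℝ, HasDerivAt (fun z : ℝ => resolventSum q n 1 a w z - resolventSum q n 1 a w 0 -
      resolventSum q' n 2 a w 0 * z) (resolventSum q' n 2 a w z - resolventSum q' n 2 a w 0) z :=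
    fun z => ((hf z).sub_const _).fun_sub
      (by simpa using (Complex.ofRealCLM.hasDerivAt (x := z)).const_mul (resolventSum q' n 2 a w 0))
  have hb' : ∀ z, ‖resolventSum q' n 2 a w z‖ ≤ M' := norm_resolventSum_le q' n 2 ha hw
  have hb'' : ∀ z, ‖resolventSum q'' n 3 a w z‖ ≤ M'' := norm_resolventSum_le q'' n 3 ha hw
  have c0 : ∀ z, 0 ≤ z → ‖resolventSum q' n 2 a w z - resolventSum q' n 2 a w 0‖ ≤ M'' * z :=
    fun z hz => norm_sub_le_of_hasDerivAt_of_norm_le hz hf' fun t _ _ => hb'' t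
  have c1 : ∀ z, ‖resolventSum q' n 2 a w z - resolventSum q' n 2 a w 0‖ ≤ 2 * M' := fun z => by
    have := norm_sub_le (resolventSum q' n 2 a w z) (resolventSum q' n 2 a w 0)
    linarith [hb' z, hb' 0]
  have b0 : ∀ z : ℝ, 0 < z → ‖resolventSum q n 1 a w z - resolventSum q n 1 a w 0 -
      resolventSum q' n 2 a w 0 * z‖ ≤ (M'' + 2 * M') * z ^ (2 : ℝ) := fun z hz => by
    -- The mean value inequality applied once more, to the linear bound `c0` on the derivative,
    -- gives the quadratic bound.
    have := norm_sub_le_of_hasDerivAt_of_norm_le (M := M'' * z) hz.le hφ fun t ht htz =>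
      (c0 t ht).trans (by gcongr)
    simp only [sub_self, Complex.ofReal_zero, mul_zero, sub_zero] at this
    rw [rpow_two]
    nlinarith [mul_nonneg hM₀' (sq_nonneg z)]
  have b1 : ∀ z : ℝ, 0 < z → ‖resolventSum q n 1 a w z - resolventSum q n 1 a w 0 -
      resolventSum q' n 2 a w 0 * z‖ ≤ (M'' + 2 * M') * z ^ (1 : ℝ) := fun z hz => by
    have := norm_sub_le_of_hasDerivAt_of_norm_le (M := 2 * M') hz.le hφ fun t _ _ => c1 t
    simp only [sub_self, Complex.ofReal_zero, mul_zero, sub_zero] at this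
    rw [rpow_one]
    nlinarith
  have b0' : ∀ z, 0 < z → ‖resolventSum q' n 2 a w z - resolventSum q' n 2 a w 0‖ ≤
      (M'' + 2 * M') * z ^ (1 : ℝ) := fun z hz => by
    rw [rpow_one]
    nlinarith [c0 z hz.le]
  have b1' : ∀ z, 0 < z → ‖resolventSum q' n 2 a w z - resolventSum q' n 2 a w 0‖ ≤
      (M'' + 2 * M') * z ^ (0 : ℝ) := fun z hz => by
    rw [rpow_zero]
    linarith [c1 z]
  have b0'' : ∀ z, 0 < z → ‖resolventSum q'' n 3 a w z‖ ≤
      M'' * (1 + ‖a‖) * z ^ ((1 : ℝ) - 1) := fun z _ => by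
    rw [sub_self, rpow_zero]
    nlinarith [hb'' z, norm_nonneg a]
  have b1'' : ∀ z, 0 < z → ‖resolventSum q'' n 3 a w z‖ ≤
      M'' * (1 + ‖a‖) * z ^ ((0 : ℝ) - 1) := fun z hz => by
    rw [zero_sub]
    exact norm_resolventSum_le_mul_rpow q'' n (by simp) ha hw hw₁ hz
  have hc := continuous_resolventSum q n 1 ha hw
  have hc' := continuous_resolventSum q' n 2 ha hw
  refine ⟨integrableOn_Ioi_div_rpow (by fun_prop) b0 b1 (by linarith) (by linarith), ?_⟩
  have s1 := integral_Ioi_div_rpow_add_one (β := α) hφ (by fun_prop) b0 b1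
    (by norm_num only [sub_self]; exact b0') (by norm_num only [sub_self]; exact b1') hα₂ hα₁
    (by linarith)
  have s2 := integral_Ioi_div_rpow_add_one (β := α - 1) hψ (continuous_resolventSum q'' n 3 ha hw)
    b0' b1' b0'' b1'' (by linarith) (by linarith) (by linarith)
  rw [add_sub_cancel] at s2
  rw [s1, s2, (integral_resolventSum_div_rpow q'' n (show 1 ≤ 3 by simp)
    (show 0 < α - 1 by linarith) (by linarith) ha hw hw₁).2]
  push_cast
  have h1 : Complex.Gamma (1 - (α - 1)) = (-α + 1) * (-α * Complex.Gamma (-α)) := by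
    rw [← Complex.Gamma_add_one _ (neg_ne_zero.2 hα), ← Complex.Gamma_add_one]
    · congr 1; ring
    · intro h
      exact hα' (by linear_combination -h)
  rw [h1, Complex.cpow_sub _ _ hw₀, Complex.cpow_sub _ _ hw₀, Complex.cpow_one, gammaSum]
  simp only [Finset.mul_sum]
  refine Finset.sum_congr rfl fun j _ => ?_
  have hj : (j : ℂ) + 1 ≠ 0 := by exact_mod_cast j.succ_ne_zero
  have hj' : (j : ℂ) + 2 ≠ 0 := by exact_mod_cast (j + 1).succ_ne_zero
  push_cast [hq'', hq']
  have h2 : Complex.Gamma (j + 3) = (j + 2) * ((j + 1) * Complex.Gamma (j + 1)) := by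
    rw [← Complex.Gamma_add_one _ hj, show (j : ℂ) + 1 + 1 = j + 2 by ring,
      ← Complex.Gamma_add_one _ hj']
    congr 1; ring
  rw [show (j : ℂ) + 3 - 1 + (α - 1) = j + 1 + α by ring, h2]
  field_simp
  ring

end

/-! ### Principal values as absolutely convergent integrals over the half-line. -/

theorem setIntegral_abs_mem {T : Set ℝ} (hT : MeasurableSet T) (hT₀ : T ⊆ Ioi 0) {f : ℝ → ℂ}
    (h₁ : IntegrableOn f T) (h₂ : IntegrableOn (fun y => f (-y)) T) :
    IntegrableOn f {y | |y| ∈ T} ∧ ∫ y in {y | |y| ∈ T}, f y = ∫ y in T, (f y + f (-y)) := by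
  have hmp := Measure.measurePreserving_neg (volume : Measure ℝ)
  have hemb : MeasurableEmbedding (Neg.neg : ℝ → ℝ) := (MeasurableEquiv.neg ℝ).measurableEmbedding
  have hset : {y : ℝ | |y| ∈ T} = T ∪ Neg.neg ⁻¹' T := by
    ext y
    simp only [mem_ofPred_eq, mem_union, mem_preimage]
    rcases le_total 0 y with h | h
    · rw [abs_of_nonneg h]
      refine ⟨Or.inl, fun h' => h'.elim id fun h'' => ?_⟩
      have : 0 < -y := hT₀ h''
      linarith
    · rw [abs_of_nonpos h]
      refine ⟨Or.inr, fun h' => h'.elim (fun h'' => ?_) id⟩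
      have : 0 < y := hT₀ h''
      linarith
  have hdisj : Disjoint T (Neg.neg ⁻¹' T) := by
    rw [Set.disjoint_left]
    intro y h1 h2
    have h1' : 0 < y := hT₀ h1
    have h2' : 0 < -y := hT₀ h2
    linarith
  have h₃ : IntegrableOn f (Neg.neg ⁻¹' T) := by
    have := (hmp.integrableOn_comp_preimage hemb (f := fun y => f (-y)) (s := T)).2 h₂
    simpa [Function.comp_def] using this
  have h₄ : ∫ y in Neg.neg ⁻¹' T, f y = ∫ y in T, f (-y) := by
    simpa using hmp.setIntegral_preimage_emb hemb (fun y => f (-y)) T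
  refine ⟨hset ▸ h₁.union h₃, ?_⟩
  rw [hset, setIntegral_union hdisj (hmp.measurable hT) h₁ h₃, h₄, integral_add h₁ h₂]

/-- Folding `y` and `-y` together replaces the integrand by a second difference. Once that is
integrable on the half-line, the truncations converge to its integral by exhaustion. -/
theorem fracLap_of_integrableOn {α : ℝ} (hα : 0 < α) {u : ℝ → ℂ} {M : ℝ} (hu : Continuous u)
    (hM : ∀ y, ‖u y‖ ≤ M) {x : ℝ}
    (hi : IntegrableOn (fun y : ℝ => (2 * u x - u (x + y) - u (x - y)) / ((y ^ (1 + α) : ℝ) : ℂ))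
      (Ioi 0)) :
    FracLapExists α u x ∧ fracLap α u x = fracLapConst α *
      ∫ y in Ioi (0 : ℝ), (2 * u x - u (x + y) - u (x - y)) / ((y ^ (1 + α) : ℝ) : ℂ) := by
  have hint : ∀ {v : ℝ → ℂ} {ε : ℝ}, Continuous v → (∀ y, ‖v y‖ ≤ M) → 0 < ε →
      IntegrableOn (fun y : ℝ => (u x - v y) / ((|y| ^ (1 + α) : ℝ) : ℂ)) (Ioi ε) := by
    intro v ε hv hvM hε
    have h : IntegrableOn (fun y : ℝ => (M + M) * y ^ (-(1 + α))) (Ioi ε) :=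
      (integrableOn_Ioi_rpow_of_lt (by linarith) hε).const_mul _
    refine h.mono' (Measurable.aestronglyMeasurable ?_) ?_
    · have := hv.measurable
      fun_prop
    · filter_upwards [ae_restrict_mem measurableSet_Ioi] with y hy
      have hy : 0 < y := hε.trans hy
      rw [norm_div, Complex.norm_real, Real.norm_of_nonneg (by positivity), abs_of_pos hy,
        rpow_neg hy.le, div_eq_mul_inv]
      gcongr
      exact (norm_sub_le _ _).trans (add_le_add (hM x) (hvM y))
  have key : ∀ ε : ℝ, 0 < ε → IntegrableOn (fracLapIntegrand α u x) {y : ℝ | ε < |y|} ∧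
      fracLapTrunc α u x ε = ∫ y in Ioi ε,
        (2 * u x - u (x + y) - u (x - y)) / ((y ^ (1 + α) : ℝ) : ℂ) := by
    intro ε hε
    obtain ⟨h1, h2⟩ := setIntegral_abs_mem measurableSet_Ioi (Ioi_subset_Ioi hε.le)
      (f := fracLapIntegrand α u x)
      (hint (v := fun y => u (x + y)) (by fun_prop) (fun _ => hM _) hε)
      (by
        simp only [fracLapIntegrand, abs_neg]
        exact hint (v := fun y => u (x + -y)) (by fun_prop) (fun _ => hM _) hε)
    refine ⟨h1, h2.trans (setIntegral_congr_fun measurableSet_Ioi fun y hy => ?_)⟩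
    have hy : 0 < y := hε.trans hy
    simp only [fracLapIntegrand, abs_neg, abs_of_pos hy, ← sub_eq_add_neg]
    ring
  have lim : Tendsto (fracLapTrunc α u x) (𝓝[>] 0) (𝓝 (∫ y in Ioi (0 : ℝ),
      (2 * u x - u (x + y) - u (x - y)) / ((y ^ (1 + α) : ℝ) : ℂ))) := by
    have h := (aecover_Ioi_of_Ioi (μ := volume) (l := 𝓝[>] (0 : ℝ)) (a := id) (A := 0)
      (tendsto_id.mono_left nhdsWithin_le_nhds)).integral_tendsto_of_countably_generated hi
    refine h.congr' ?_
    filter_upwards [self_mem_nhdsWithin] with ε hε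
    rw [(key ε hε).2, Measure.restrict_restrict measurableSet_Ioi, id,
      inter_eq_left.2 (Ioi_subset_Ioi (le_of_lt hε))]
  exact ⟨⟨fun ε hε => (key ε hε).1, _, lim⟩, by rw [fracLap, lim.limUnder_eq]⟩

/-- After the substitution `y = x - z` the kernel is odd, so folding leaves `u (x - y) - u (x + y)`.
Both cutoffs are removed at once because `(ε, R)` exhausts the half-line. -/
theorem hilbert_of_integrableOn {u : ℝ → ℂ} (hu : Continuous u) {x : ℝ}
    (hi : IntegrableOn (fun y : ℝ => (u (x - y) - u (x + y)) / y) (Ioi 0)) :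
    HilbertExists u x ∧ hilbertTransform u x = 1 / π *
      ∫ y in Ioi (0 : ℝ), (u (x - y) - u (x + y)) / y := by
  have hint : ∀ {v : ℝ → ℂ} {ε R : ℝ}, Continuous v → 0 < ε →
      IntegrableOn (fun y : ℝ => v y / y) (Ioo ε R) := by
    intro v ε R hv hε
    refine IntegrableOn.mono_set (ContinuousOn.integrableOn_Icc ?_) Ioo_subset_Icc_self
    exact hv.continuousOn.div Complex.continuous_ofReal.continuousOn fun y hy => by
      exact_mod_cast (hε.trans_le hy.1).ne'
  have hmp := Measure.measurePreserving_sub_left (volume : Measure ℝ) x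
  have hemb : MeasurableEmbedding (fun y : ℝ => x - y) :=
    (MeasurableEquiv.subLeft x).measurableEmbedding
  have key : ∀ ε R : ℝ, 0 < ε →
      IntegrableOn (fun z : ℝ => u z / ((x : ℂ) - z)) {z : ℝ | ε < |x - z| ∧ |x - z| < R} ∧
      hilbertTrunc u x (ε, R) = ∫ y in Ioo ε R, (u (x - y) - u (x + y)) / y := by
    intro ε R hε
    obtain ⟨h1, h2⟩ := setIntegral_abs_mem (f := fun y : ℝ => u (x - y) / y)
      (measurableSet_Ioo (a := ε) (b := R)) (fun y hy => hε.trans hy.1)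
      (hint (v := fun y => u (x - y)) (by fun_prop) hε)
      (by
        have := (hint (R := R) (v := fun y => u (x - -y)) (by fun_prop) hε).neg
        refine this.congr_fun (fun y _ => ?_) measurableSet_Ioo
        simp [div_neg])
    have e : ∀ z : ℝ, u z / ((x : ℂ) - z) = u (x - (x - z)) / ((x - z : ℝ) : ℂ) := by
      intro z
      simp
    constructor
    · simp_rw [e]
      exact (hmp.integrableOn_comp_preimage hemb (f := fun y : ℝ => u (x - y) / y)
        (s := {y : ℝ | |y| ∈ Ioo ε R})).2 h1
    · simp only [hilbertTrunc, e]
      refine (hmp.setIntegral_preimage_emb hemb (fun y : ℝ => u (x - y) / y)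
        {y : ℝ | |y| ∈ Ioo ε R}).trans (h2.trans ?_)
      refine setIntegral_congr_fun measurableSet_Ioo fun y hy => ?_
      simp only [sub_neg_eq_add, Complex.ofReal_neg, div_neg]
      ring
  have lim : Tendsto (hilbertTrunc u x) (𝓝[>] 0 ×ˢ atTop) (𝓝 (∫ y in Ioi (0 : ℝ),
      (u (x - y) - u (x + y)) / y)) := by
    have h := ((aecover_Ioi_of_Ioi (μ := volume) (l := 𝓝[>] (0 : ℝ) ×ˢ (atTop : Filter ℝ))
      (a := Prod.fst) (A := 0) (tendsto_fst.mono_right nhdsWithin_le_nhds)).inter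
      ((aecover_Iio (μ := volume.restrict (Ioi (0 : ℝ)))
        (b := (Prod.snd : ℝ × ℝ → ℝ)) tendsto_snd))).integral_tendsto_of_countably_generated hi
    refine h.congr' ?_
    filter_upwards [tendsto_fst.eventually (self_mem_nhdsWithin (s := Ioi (0 : ℝ)))] with p hp
    rw [(key p.1 p.2 hp).2, Measure.restrict_restrict (measurableSet_Ioi.inter measurableSet_Iio),
      Ioi_inter_Iio, inter_eq_left.2 (show Ioo p.1 p.2 ⊆ Ioi 0 from fun y hy => lt_trans hp hy.1)]
  exact ⟨⟨fun ε R hε => (key ε R hε).1, _, lim⟩, by rw [hilbertTransform, lim.limUnder_eq]⟩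

/-! ### Hilbert-type integrals of resolvent powers. -/

section
variable {a w : ℂ}

theorem eq_I_or_eq_neg_I (hw : w.re = 0) (hw₁ : ‖w‖ = 1) : w = Complex.I ∨ w = -Complex.I := by
  have h : w.im ^ 2 = 1 := by
    have := Complex.sq_norm w
    rw [hw₁, Complex.normSq_apply, hw] at this
    nlinarith
  rcases (sq_eq_sq_iff_eq_or_eq_neg (b := (1 : ℝ))).1 (by rw [h, one_pow]) with h | h
  · exact Or.inl (Complex.ext (by simp [hw]) (by simp [h]))
  · exact Or.inr (Complex.ext (by simp [hw]) (by simp [h]))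

theorem tendsto_inv_add_mul_atTop (ha : a.re = 1) (hw : w.re = 0) (hw₁ : ‖w‖ = 1) :
    Tendsto (fun y : ℝ => (a + w * y)⁻¹) atTop (𝓝 0) := by
  refine squeeze_zero_norm' ?_ (by
    simpa using (tendsto_rpow_neg_atTop one_pos).const_mul (1 + ‖a‖))
  filter_upwards [eventually_gt_atTop 0] with y hy
  exact norm_inv_add_mul_le ha hw hw₁ hy

theorem hasDerivAt_add_mul_ofReal (a w : ℂ) (y : ℝ) :
    HasDerivAt (fun y : ℝ => a + w * y) w y := by
  simpa using ((Complex.ofRealCLM.hasDerivAt (x := y)).const_mul w).const_add a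

theorem integrableOn_inv_mul_inv (ha : a.re = 1) (hw : w.re = 0) (hw₁ : ‖w‖ = 1) {v : ℂ}
    (hv : v.re = 0) (hv₁ : ‖v‖ = 1) (r : ℕ) :
    IntegrableOn (fun y : ℝ => (a + w * y)⁻¹ ^ (r + 1) * (a + v * y)⁻¹) (Ioi 0) := by
  have hc : Continuous (fun y : ℝ => (a + w * y)⁻¹ ^ (r + 1) * (a + v * y)⁻¹) :=
    ((Continuous.inv₀ (by fun_prop) (add_mul_ne_zero ha hw)).pow _).mul
      (Continuous.inv₀ (by fun_prop) (add_mul_ne_zero ha hv))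
  have hb : ∀ y : ℝ, ‖(a + w * y)⁻¹ ^ (r + 1) * (a + v * y)⁻¹‖ ≤
      ‖(a + w * y)⁻¹‖ * ‖(a + v * y)⁻¹‖ := fun y => by
    rw [norm_mul, norm_pow, pow_succ]
    gcongr
    exact mul_le_of_le_one_left (norm_nonneg _)
      (pow_le_one₀ (norm_nonneg _) (norm_inv_add_mul_le_one ha hw y))
  -- Trivial weight `s = 0`: the product is bounded and decays like `y ^ (-2)`.
  have := integrableOn_Ioi_div_rpow (s := 0) (p := 0) (q := -2) (C := (1 + ‖a‖) ^ 2) hc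
    (fun z hz => by
      rw [rpow_zero, mul_one]
      refine (hb z).trans ((mul_le_one₀ (norm_inv_add_mul_le_one ha hw z) (norm_nonneg _)
        (norm_inv_add_mul_le_one ha hv z)).trans (one_le_pow₀ ?_))
      linarith [norm_nonneg a])
    (fun z hz => by
      refine (hb z).trans ((mul_le_mul (norm_inv_add_mul_le ha hw hw₁ hz)
        (norm_inv_add_mul_le ha hv hv₁ hz) (norm_nonneg _) (by positivity)).trans_eq ?_)
      rw [show (-2 : ℝ) = -1 + -1 by norm_num, rpow_add hz]
      ring)
    (by norm_num) (by norm_num)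
  simpa using this

/-- The primitive `w⁻¹ (log (a + w y) - log (a - w y))` vanishes at 0 and tends to `w⁻¹ (log w - log
(-w)) = π`. The sum is integrable although each summand only decays like `1 / y`. -/
theorem integral_inv_add_inv (ha : a.re = 1) (hw : w.re = 0) (hw₁ : ‖w‖ = 1) :
    IntegrableOn (fun y : ℝ => (a + -w * y)⁻¹ + (a + w * y)⁻¹) (Ioi 0) ∧
    ∫ y in Ioi (0 : ℝ), ((a + -w * y)⁻¹ + (a + w * y)⁻¹) = π := by
  have hw' : (-w).re = 0 := by simp [hw]
  have hw₁' : ‖-w‖ = 1 := by simp [hw₁]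
  have hw₀ : w ≠ 0 := by rintro rfl; simp at hw₁
  have hi : IntegrableOn (fun y : ℝ => (a + -w * y)⁻¹ + (a + w * y)⁻¹) (Ioi 0) := by
    have := (integrableOn_inv_mul_inv ha hw' hw₁' hw hw₁ 0).const_mul (2 * a)
    refine IntegrableOn.congr_fun this (fun y _ => ?_) measurableSet_Ioi
    have h1 := mul_inv_cancel₀ (add_mul_ne_zero ha hw y)
    have h2 := mul_inv_cancel₀ (add_mul_ne_zero ha hw' y)
    simp only [zero_add, pow_one]
    linear_combination (a + -w * y)⁻¹ * h1 + (a + w * y)⁻¹ * h2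
  refine ⟨hi, ?_⟩
  have hder : ∀ v : ℂ, v.re = 0 → ∀ y : ℝ,
      HasDerivAt (fun y : ℝ => Complex.log (a + v * y)) (v * (a + v * y)⁻¹) y := fun v hv y => by
    have := (hasDerivAt_add_mul_ofReal a v y).clog_real (Or.inl (by simp [ha, hv]))
    rwa [div_eq_mul_inv] at this
  have hF : ∀ y : ℝ, HasDerivAt
      (fun y : ℝ => w⁻¹ * (Complex.log (a + w * y) - Complex.log (a + -w * y)))
      ((a + -w * y)⁻¹ + (a + w * y)⁻¹) y := fun y => by
    refine (((hder w hw y).fun_sub (hder (-w) hw' y)).const_mul w⁻¹).congr_deriv ?_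
    field_simp
    ring
  have hlim : ∀ v : ℂ, v.re = 0 → ‖v‖ = 1 →
      Tendsto (fun y : ℝ => Complex.log (v + a * ((y⁻¹ : ℝ) : ℂ))) atTop
        (𝓝 (Complex.log v)) := fun v hv hv₁ => by
    refine Tendsto.clog ?_ (Or.inr fun h => ?_)
    · have h1 : Tendsto (fun y : ℝ => ((y⁻¹ : ℝ) : ℂ)) atTop (𝓝 0) := by
        simpa [Function.comp_def] using
          (Complex.continuous_ofReal.tendsto 0).comp tendsto_inv_atTop_zero
      simpa using (h1.const_mul a).const_add v
    · rw [Complex.ext (z := v) (w := 0) hv h] at hv₁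
      simp at hv₁
  have hval : w⁻¹ * (Complex.log w - Complex.log (-w)) = π := by
    rcases eq_I_or_eq_neg_I hw hw₁ with rfl | rfl
    · rw [Complex.log_I, Complex.log_neg_I]
      field_simp
      ring
    · rw [neg_neg, Complex.log_I, Complex.log_neg_I, inv_neg]
      field_simp
      ring
  -- Pulling out the positive factor `y` isolates the divergent `log y`, which cancels in the
  -- difference.
  have hsplit : ∀ v : ℂ, v.re = 0 → ∀ y : ℝ, 0 < y →
      Complex.log (a + v * y) = Real.log y + Complex.log (v + a * ((y⁻¹ : ℝ) : ℂ)) := by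
    intro v hv y hy
    have hy' : (y : ℂ) ≠ 0 := by exact_mod_cast hy.ne'
    have e : a + v * y = y * (v + a * ((y⁻¹ : ℝ) : ℂ)) := by
      push_cast
      field_simp
      ring
    rw [e, Complex.log_ofReal_mul hy]
    intro h
    apply add_mul_ne_zero ha hv y
    rw [e, h, mul_zero]
  have key := integral_Ioi_of_hasDerivAt_of_tendsto (hF 0).continuousAt.continuousWithinAt
    (fun y _ => hF y) hi (m := (π : ℂ)) (by
      rw [← hval]
      refine Tendsto.congr' ?_ (((hlim w hw hw₁).sub (hlim (-w) hw' hw₁')).const_mul w⁻¹)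
      filter_upwards [eventually_gt_atTop 0] with y hy
      rw [hsplit w hw y hy, hsplit (-w) hw' y hy]
      ring)
  simpa using key

/-- The primitive is a difference of powers `r + 1`, which vanishes at 0 by symmetry and at infinity
by decay. -/
theorem integral_inv_pow_add_inv_pow (ha : a.re = 1) (hw : w.re = 0) (hw₁ : ‖w‖ = 1) (r : ℕ) :
    IntegrableOn (fun y : ℝ => (a + -w * y)⁻¹ ^ (r + 2) + (a + w * y)⁻¹ ^ (r + 2)) (Ioi 0) ∧
    ∫ y in Ioi (0 : ℝ), ((a + -w * y)⁻¹ ^ (r + 2) + (a + w * y)⁻¹ ^ (r + 2)) = 0 := by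
  have hw' : (-w).re = 0 := by simp [hw]
  have hw₁' : ‖-w‖ = 1 := by simp [hw₁]
  have hw₀ : w ≠ 0 := by rintro rfl; simp at hw₁
  have hr : (r : ℂ) + 1 ≠ 0 := by exact_mod_cast r.succ_ne_zero
  have hi := (integrableOn_inv_mul_inv ha hw' hw₁' hw' hw₁' r).add
    (integrableOn_inv_mul_inv ha hw hw₁ hw hw₁ r)
  simp only [← pow_succ] at hi
  refine ⟨hi, ?_⟩
  have hder : ∀ v : ℂ, v.re = 0 → ∀ y : ℝ, HasDerivAt (fun y : ℝ => (a + v * y)⁻¹ ^ (r + 1))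
      (-v * (r + 1) * (a + v * y)⁻¹ ^ (r + 2)) y := fun v hv y => by
    have h0 := add_mul_ne_zero ha hv y
    refine (((hasDerivAt_add_mul_ofReal a v y).fun_inv h0).fun_pow (r + 1)).congr_deriv ?_
    push_cast
    rw [pow_add _ r 2]
    field_simp
  have hF : ∀ y : ℝ, HasDerivAt (fun y : ℝ => (w * (r + 1))⁻¹ *
      ((a + -w * y)⁻¹ ^ (r + 1) - (a + w * y)⁻¹ ^ (r + 1)))
      ((a + -w * y)⁻¹ ^ (r + 2) + (a + w * y)⁻¹ ^ (r + 2)) y := fun y => by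
    refine (((hder (-w) hw' y).fun_sub (hder w hw y)).const_mul _).congr_deriv ?_
    field_simp
    ring
  have key := integral_Ioi_of_hasDerivAt_of_tendsto (hF 0).continuousAt.continuousWithinAt
    (fun y _ => hF y) hi (m := 0) (by
      simpa using (((tendsto_inv_add_mul_atTop ha hw' hw₁').pow (r + 1)).sub
        ((tendsto_inv_add_mul_atTop ha hw hw₁).pow (r + 1))).const_mul (w * (r + 1))⁻¹)
  simpa using key

/-- Induction on `r` by `(a ± w y)⁻¹ = a⁻¹ (1 ∓ w y (a ± w y)⁻¹)`: the previous case is multiplied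
by `a⁻¹`, and the extra `y` cancels the denominator. The remaining integral is `π` at the first step
and 0 afterwards. -/
theorem integral_inv_pow_sub_inv_pow_div (ha : a.re = 1) (hw : w.re = 0) (hw₁ : ‖w‖ = 1) (r : ℕ) :
    IntegrableOn (fun y : ℝ => ((a + -w * y)⁻¹ ^ (r + 1) - (a + w * y)⁻¹ ^ (r + 1)) / y) (Ioi 0) ∧
    ∫ y in Ioi (0 : ℝ), ((a + -w * y)⁻¹ ^ (r + 1) - (a + w * y)⁻¹ ^ (r + 1)) / y =
      π * w * a⁻¹ ^ (r + 1) := by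
  have hw' : (-w).re = 0 := by simp [hw]
  have ha₀ : a ≠ 0 := by rintro rfl; simp at ha
  have e : ∀ (r : ℕ) (y : ℝ), y ∈ Ioi 0 →
      ((a + -w * y)⁻¹ ^ (r + 1) - (a + w * y)⁻¹ ^ (r + 1)) / y =
      a⁻¹ * (((a + -w * y)⁻¹ ^ r - (a + w * y)⁻¹ ^ r) / y) +
      a⁻¹ * w * ((a + -w * y)⁻¹ ^ (r + 1) + (a + w * y)⁻¹ ^ (r + 1)) := by
    intro r y hy
    have hy' : (y : ℂ) ≠ 0 := by exact_mod_cast (ne_of_gt hy)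
    have h1 : (a + -w * y)⁻¹ = a⁻¹ * (1 + w * y * (a + -w * y)⁻¹) := by
      linear_combination a⁻¹ * mul_inv_cancel₀ (add_mul_ne_zero ha hw' y) -
        (a + -w * y)⁻¹ * mul_inv_cancel₀ ha₀
    have h2 : (a + w * y)⁻¹ = a⁻¹ * (1 - w * y * (a + w * y)⁻¹) := by
      linear_combination a⁻¹ * mul_inv_cancel₀ (add_mul_ne_zero ha hw y) -
        (a + w * y)⁻¹ * mul_inv_cancel₀ ha₀
    have h3 : (a + -w * y)⁻¹ ^ (r + 1) =
        a⁻¹ * ((a + -w * y)⁻¹ ^ r + w * y * (a + -w * y)⁻¹ ^ (r + 1)) := by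
      rw [pow_succ]
      linear_combination (a + -w * y)⁻¹ ^ r * h1
    have h4 : (a + w * y)⁻¹ ^ (r + 1) =
        a⁻¹ * ((a + w * y)⁻¹ ^ r - w * y * (a + w * y)⁻¹ ^ (r + 1)) := by
      rw [pow_succ]
      linear_combination (a + w * y)⁻¹ ^ r * h2
    rw [div_eq_iff hy', add_mul, mul_assoc a⁻¹, div_mul_cancel₀ _ hy']
    linear_combination h3 - h4
  induction r with
  | zero =>
    obtain ⟨h1, h2⟩ := integral_inv_add_inv ha hw hw₁
    have e' : EqOn (fun y : ℝ => ((a + -w * y)⁻¹ ^ (0 + 1) - (a + w * y)⁻¹ ^ (0 + 1)) / y)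
        (fun y : ℝ => a⁻¹ * w * ((a + -w * y)⁻¹ + (a + w * y)⁻¹)) (Ioi 0) := fun y hy => by
      simpa using e 0 y hy
    refine ⟨IntegrableOn.congr_fun (h1.const_mul _) e'.symm measurableSet_Ioi, ?_⟩
    rw [setIntegral_congr_fun measurableSet_Ioi e', integral_const_mul, h2]
    ring
  | succ r ih =>
    obtain ⟨h1, h2⟩ := integral_inv_pow_add_inv_pow ha hw hw₁ r
    refine ⟨IntegrableOn.congr_fun ((ih.1.const_mul _).add (h1.const_mul _))
      (fun y hy => (e (r + 1) y hy).symm) measurableSet_Ioi, ?_⟩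
    rw [setIntegral_congr_fun measurableSet_Ioi (e (r + 1)), integral_add (ih.1.const_mul _)
      (h1.const_mul _), integral_const_mul, integral_const_mul, ih.2, h2]
    ring

/-- Up to the factor `π`, the Hilbert transform is multiplication by `w` on these sums. The case `m
= 0` serves the function itself, `m = 1` its derivative. -/
theorem integral_resolventSum_sub_div (q : ℕ → ℂ) (n m : ℕ) (ha : a.re = 1) (hw : w.re = 0)
    (hw₁ : ‖w‖ = 1) :
    IntegrableOn (fun y : ℝ => (resolventSum q n (m + 1) a (-w) y -
      resolventSum q n (m + 1) a w y) / y) (Ioi 0) ∧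
    ∫ y in Ioi (0 : ℝ), (resolventSum q n (m + 1) a (-w) y - resolventSum q n (m + 1) a w y) / y =
      π * w * resolventSum q n (m + 1) a w 0 := by
  have e : ∀ y : ℝ, (resolventSum q n (m + 1) a (-w) y - resolventSum q n (m + 1) a w y) / y =
      ∑ j ∈ Finset.range n, q j * (((a + -w * y)⁻¹ ^ (j + m + 1) - (a + w * y)⁻¹ ^ (j + m + 1)) / y)
      := by
    intro y
    simp only [resolventSum, ← Finset.sum_sub_distrib, Finset.sum_div, ← mul_sub, mul_div_assoc,
      add_assoc]
  have hint : ∀ j ∈ Finset.range n, Integrable (fun y : ℝ => q j *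
      (((a + -w * y)⁻¹ ^ (j + m + 1) - (a + w * y)⁻¹ ^ (j + m + 1)) / y))
      (volume.restrict (Ioi 0)) := fun j _ =>
    (integral_inv_pow_sub_inv_pow_div ha hw hw₁ (j + m)).1.const_mul (q j)
  simp_rw [e]
  refine ⟨integrable_finsetSum _ hint, ?_⟩
  rw [integral_finsetSum _ hint, resolventSum, Finset.mul_sum]
  refine Finset.sum_congr rfl fun j _ => ?_
  rw [integral_const_mul, (integral_inv_pow_sub_inv_pow_div ha hw hw₁ (j + m)).2]
  simp only [Complex.ofReal_zero, mul_zero, add_zero, ← add_assoc]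
  ring

end

/-! ### Normalising constants and phases. -/

/-- The reflection formula at `-α` and the double-angle formula; `sin (π α)` is nonzero as `α ≠ 1`.
-/
theorem Gamma_neg_mul_Gamma_one_add {α : ℝ} (hα₀ : 0 < α) (hα₂ : α < 2) (hα₁ : α ≠ 1) :
    Real.Gamma (-α) * (Real.Gamma (1 + α) / π) *
      (2 * Real.sin (α * (π / 2)) * Real.cos (α * (π / 2))) = -1 := by
  have h := Real.Gamma_mul_Gamma_one_sub (-α)
  have hs : Real.sin (π * -α) = -(2 * Real.sin (α * (π / 2)) * Real.cos (α * (π / 2))) := by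
    rw [← Real.sin_two_mul, ← Real.sin_neg]
    congr 1; ring
  have hs₀ : Real.sin (π * -α) ≠ 0 := by
    rw [Ne, Real.sin_eq_zero_iff]
    rintro ⟨m, hm⟩
    have hm' : (m : ℝ) = -α := by
      have := pi_pos.ne'
      exact mul_right_cancel₀ this (by linarith)
    have h1 : (-2 : ℝ) < m := by linarith
    have h2 : (m : ℝ) < 0 := by linarith
    have h1' : -2 < m := by exact_mod_cast h1
    have h2' : m < 0 := by exact_mod_cast h2
    have : m = -1 := by lia
    rw [this] at hm'
    push_cast at hm'
    exact hα₁ (by linarith)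
  rw [sub_neg_eq_add, eq_div_iff hs₀, hs] at h
  rw [show Real.Gamma (-α) * (Real.Gamma (1 + α) / π) *
    (2 * Real.sin (α * (π / 2)) * Real.cos (α * (π / 2))) = -(Real.Gamma (-α) *
    Real.Gamma (1 + α) * -(2 * Real.sin (α * (π / 2)) * Real.cos (α * (π / 2)))) / π by ring, h,
    neg_div, div_self pi_pos.ne']

/-- Legendre duplication at `1 / 2 + α / 2` combined with reflection at `α / 2`. -/
theorem fracLapConst_eq {α : ℝ} (hα₀ : 0 < α) (hα₂ : α < 2) :
    fracLapConst α = Real.Gamma (1 + α) / π * Real.sin (α * (π / 2)) := by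
  have h1 := Real.Gamma_mul_Gamma_add_half (1 / 2 + α / 2)
  have h2 := Real.Gamma_mul_Gamma_one_sub (α / 2)
  have h3 : Real.Gamma (1 / 2 + α / 2 + 1 / 2) = α / 2 * Real.Gamma (α / 2) := by
    rw [← Real.Gamma_add_one (by positivity)]
    congr 1; ring
  have hs : 0 < Real.sin (α * (π / 2)) :=
    Real.sin_pos_of_pos_of_lt_pi (by positivity) (by nlinarith [pi_pos])
  have hG : 0 < Real.Gamma (1 - α / 2) := Real.Gamma_pos_of_pos (by linarith)
  have hG' : 0 < Real.Gamma (α / 2) := Real.Gamma_pos_of_pos (by linarith)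
  have hp : (0 : ℝ) < 2 ^ α := by positivity
  rw [h3, show 2 * (1 / 2 + α / 2) = 1 + α by ring, show 1 - (1 + α) = -α by ring,
    rpow_neg zero_le_two] at h1
  rw [show π * (α / 2) = α * (π / 2) by ring] at h2
  rw [fracLapConst, rpow_sub_one two_ne_zero, div_eq_iff (by positivity)]
  rw [eq_div_iff hs.ne'] at h2
  refine mul_right_cancel₀ (mul_pos hG' pi_pos).ne' ?_
  generalize Real.sin (α * (π / 2)) = S at *
  generalize Real.Gamma (1 - α / 2) = D at *
  generalize Real.Gamma (α / 2) = B at *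
  generalize Real.Gamma (1 / 2 + α / 2) = G at *
  generalize (2 : ℝ) ^ α = P at *
  have h4 : G * (α / 2 * B) * P = Real.Gamma (1 + α) * √π := by
    rw [h1]
    field_simp
  have h5 : Real.Gamma (1 + α) / π * S * (√π * D) * (B * π) = Real.Gamma (1 + α) * √π * π := by
    rw [← h2]
    have : B * D * S ≠ 0 := by rw [h2]; exact pi_pos.ne'
    field_simp
  rw [h5, ← h4]
  ring

section
variable {w : ℂ}

/-- The principal argument of `± I` is `± π / 2`; keeping `w` in the formula treats both signs of
`k` at once. -/
theorem cpow_eq_cos_add_sin (hw : w.re = 0) (hw₁ : ‖w‖ = 1) (s : ℝ) :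
    w ^ (s : ℂ) = Real.cos (s * (π / 2)) + w * Real.sin (s * (π / 2)) := by
  rcases eq_I_or_eq_neg_I hw hw₁ with rfl | rfl
  · rw [Complex.cpow_def_of_ne_zero Complex.I_ne_zero, Complex.log_I,
      show (π : ℂ) / 2 * Complex.I * s = ((s * (π / 2) : ℝ) : ℂ) * Complex.I by push_cast; ring,
      Complex.exp_mul_I, Complex.ofReal_cos, Complex.ofReal_sin]
    ring
  · rw [Complex.cpow_def_of_ne_zero (neg_ne_zero.2 Complex.I_ne_zero), Complex.log_neg_I,
      show -((π : ℂ) / 2) * Complex.I * s = ((-(s * (π / 2)) : ℝ) : ℂ) * Complex.I by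
        push_cast; ring,
      Complex.exp_mul_I, ← Complex.ofReal_cos, ← Complex.ofReal_sin, Real.cos_neg, Real.sin_neg]
    push_cast
    ring

theorem exp_eq_cos_add_sin (hw : w.re = 0) (hw₁ : ‖w‖ = 1) (s : ℝ) :
    Complex.exp (w * s) = Real.cos s + w * Real.sin s := by
  rcases eq_I_or_eq_neg_I hw hw₁ with rfl | rfl
  · rw [mul_comm, Complex.exp_mul_I, Complex.ofReal_cos, Complex.ofReal_sin]
    ring
  · rw [show -Complex.I * s = ((-s : ℝ) : ℂ) * Complex.I by push_cast; ring,
      Complex.exp_mul_I, ← Complex.ofReal_cos, ← Complex.ofReal_sin, Real.cos_neg, Real.sin_neg]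
    push_cast
    ring

theorem fracLapConst_mul_Gamma_neg {α : ℝ} (hα₀ : 0 < α) (hα₂ : α < 2) (hα₁ : α ≠ 1)
    (hw : w.re = 0) (hw₁ : ‖w‖ = 1) :
    (fracLapConst α : ℂ) * (Complex.Gamma (-α) * ((-w) ^ (α : ℂ) + w ^ (α : ℂ))) = -1 := by
  have h : ((Real.Gamma (-α) * (Real.Gamma (1 + α) / π) *
      (2 * Real.sin (α * (π / 2)) * Real.cos (α * (π / 2))) : ℝ) : ℂ) = ((-1 : ℝ) : ℂ) :=
    congrArg _ (Gamma_neg_mul_Gamma_one_add hα₀ hα₂ hα₁)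
  rw [fracLapConst_eq hα₀ hα₂, cpow_eq_cos_add_sin hw hw₁,
    cpow_eq_cos_add_sin (by simp [hw]) (by simp [hw₁]), ← Complex.ofReal_neg, Complex.Gamma_ofReal]
  simp only [Complex.ofReal_mul, Complex.ofReal_div, Complex.ofReal_neg, Complex.ofReal_one,
    Complex.ofReal_ofNat] at h ⊢
  linear_combination h

/-- With `A = α π / 2` and `G = γ π / 2`, the addition formulas give `sin (A - G) (cos A - w sin A)
+ sin (A + G) (cos A + w sin A) = 2 sin A cos A (cos G + w sin G)`. Reflection cancels `2 sin A cos
A`, and only the phase survives. -/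
theorem Gamma_neg_mul_rfConst {α γ : ℝ} (hα₀ : 0 < α) (hα₂ : α < 2) (hα₁ : α ≠ 1)
    (hw : w.re = 0) (hw₁ : ‖w‖ = 1) :
    Complex.Gamma (-α) * (rfConst₁ α γ * (-w) ^ (α : ℂ) + rfConst₂ α γ * w ^ (α : ℂ)) =
      -Complex.exp (w * (γ * (π / 2) : ℝ)) := by
  have h : ((Real.Gamma (-α) * (Real.Gamma (1 + α) / π) *
      (2 * Real.sin (α * (π / 2)) * Real.cos (α * (π / 2))) : ℝ) : ℂ) = ((-1 : ℝ) : ℂ) :=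
    congrArg _ (Gamma_neg_mul_Gamma_one_add hα₀ hα₂ hα₁)
  rw [exp_eq_cos_add_sin hw hw₁, cpow_eq_cos_add_sin hw hw₁,
    cpow_eq_cos_add_sin (by simp [hw]) (by simp [hw₁]), ← Complex.ofReal_neg, Complex.Gamma_ofReal,
    rfConst₁, rfConst₂, sub_mul, add_mul, Real.sin_sub, Real.sin_add]
  simp only [Complex.ofReal_mul, Complex.ofReal_div, Complex.ofReal_neg, Complex.ofReal_one,
    Complex.ofReal_ofNat, Complex.ofReal_add, Complex.ofReal_sub] at h ⊢
  linear_combination ((Real.cos (γ * (π / 2)) : ℂ) + w * Real.sin (γ * (π / 2))) * h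

theorem resolventSum_add (q : ℕ → ℂ) (n m : ℕ) (a w : ℂ) (x y : ℝ) :
    resolventSum q n m a w (x + y) = resolventSum q n m (a + w * x) w y := by
  simp only [resolventSum, Complex.ofReal_add, mul_add, add_assoc]

theorem resolventSum_sub (q : ℕ → ℂ) (n m : ℕ) (a w : ℂ) (x y : ℝ) :
    resolventSum q n m a w (x - y) = resolventSum q n m (a + w * x) (-w) y := by
  refine Finset.sum_congr rfl fun j _ => ?_
  rw [Complex.ofReal_sub, show a + w * ((x : ℂ) - y) = a + w * x + -w * y by ring]

theorem resolventSum_zero (q : ℕ → ℂ) (n m : ℕ) (a w : ℂ) (x : ℝ) :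
    resolventSum q n m (a + w * x) w 0 = resolventSum q n m a w x := by
  simp [resolventSum]

theorem resolventSum_neg (q : ℕ → ℂ) (n m : ℕ) (a : ℂ) (z : ℝ) :
    resolventSum (fun j => -(-w) * (j + 1 : ℕ) * q j) n m a (-w) z =
      -resolventSum (fun j => -w * (j + 1 : ℕ) * q j) n m a (-w) z := by
  rw [← neg_one_mul (resolventSum _ _ _ _ _ _), ← resolventSum_const_mul]
  congr 1
  ext j
  ring

end

/-! ### The operators on a constant plus a resolvent sum. -/

section
variable {w : ℂ}

theorem one_add_mul_ofReal_re (hw : w.re = 0) (x : ℝ) : (1 + w * x).re = 1 := by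
  simp [hw]

theorem hasDerivAt_one_add_resolventSum (q : ℕ → ℂ) (n : ℕ) (hw : w.re = 0) (x : ℝ) :
    HasDerivAt (fun y => 1 + resolventSum q n 1 1 w y)
      (resolventSum (fun j => -w * (j + 1 : ℕ) * q j) n 2 1 w x) x :=
  (hasDerivAt_resolventSum q n 1 (by simp) hw x).const_add 1

theorem Gamma_neg_ne_zero {α : ℝ} (hα₀ : 0 < α) (hα₂ : α < 2) (hα₁ : α ≠ 1) :
    Complex.Gamma (-α) ≠ 0 := by
  intro h
  have := fracLapConst_mul_Gamma_neg hα₀ hα₂ hα₁ Complex.I_re Complex.norm_I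
  rw [h] at this
  simp at this

/-- The second difference splits into one-sided differences in `w` and `-w`. For `α > 1` linear
Taylor terms may be inserted, since the two sides contribute opposite ones. -/
theorem fracLap_one_add_resolventSum_of_ne_one (q : ℕ → ℂ) (n : ℕ) (hw : w.re = 0) (hw₁ : ‖w‖ = 1)
    {α : ℝ} (hα₀ : 0 < α) (hα₂ : α < 2) (hα₁ : α ≠ 1) (x : ℝ) :
    FracLapExists α (fun y => 1 + resolventSum q n 1 1 w y) x ∧
    fracLap α (fun y => 1 + resolventSum q n 1 1 w y) x = gammaSum q n α (1 + w * x) := by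
  have hw' : (-w).re = 0 := by simp [hw]
  have hw₁' : ‖-w‖ = 1 := by simp [hw₁]
  have ha := one_add_mul_ofReal_re hw x
  have hM : ∀ y, ‖1 + resolventSum q n 1 1 w y‖ ≤ 1 + ∑ j ∈ Finset.range n, ‖q j‖ := fun y => by
    refine (norm_add_le _ _).trans ?_
    rw [norm_one]
    gcongr
    exact norm_resolventSum_le q n 1 (by simp) hw y
  have hc : Continuous fun y => 1 + resolventSum q n 1 1 w y :=
    continuous_const.add (continuous_resolventSum q n 1 (by simp) hw)
  have key : IntegrableOn (fun y : ℝ => (2 * (1 + resolventSum q n 1 1 w x) -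
      (1 + resolventSum q n 1 1 w (x + y)) - (1 + resolventSum q n 1 1 w (x - y))) /
        ((y ^ (1 + α) : ℝ) : ℂ)) (Ioi 0) ∧
      ∫ y in Ioi (0 : ℝ), (2 * (1 + resolventSum q n 1 1 w x) -
      (1 + resolventSum q n 1 1 w (x + y)) - (1 + resolventSum q n 1 1 w (x - y))) /
        ((y ^ (1 + α) : ℝ) : ℂ) =
      -(Complex.Gamma (-α) * w ^ (α : ℂ) * gammaSum q n α (1 + w * x) +
        Complex.Gamma (-α) * (-w) ^ (α : ℂ) * gammaSum q n α (1 + w * x)) := by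
    have z1 := resolventSum_zero q n 1 1 w x
    have z2 : resolventSum q n 1 (1 + w * x) (-w) 0 = resolventSum q n 1 1 w x := by
      rw [← z1]
      simp [resolventSum]
    rcases lt_or_gt_of_ne hα₁ with h | h
    · obtain ⟨-, -, i1, i2⟩ := integral_resolventSum_sub_div_rpow q n hα₀ h ha hw hw₁
      obtain ⟨-, -, j1, j2⟩ := integral_resolventSum_sub_div_rpow q n hα₀ h ha hw' hw₁'
      have e : ∀ y : ℝ, (2 * (1 + resolventSum q n 1 1 w x) -
          (1 + resolventSum q n 1 1 w (x + y)) - (1 + resolventSum q n 1 1 w (x - y))) /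
          ((y ^ (1 + α) : ℝ) : ℂ) =
          -((resolventSum q n 1 (1 + w * x) w y - resolventSum q n 1 (1 + w * x) w 0) /
            ((y ^ (1 + α) : ℝ) : ℂ) +
          (resolventSum q n 1 (1 + w * x) (-w) y - resolventSum q n 1 (1 + w * x) (-w) 0) /
            ((y ^ (1 + α) : ℝ) : ℂ)) := fun y => by
        rw [resolventSum_add, resolventSum_sub, z1, z2]
        ring
      simp_rw [e]
      refine ⟨(i1.add j1).neg, ?_⟩
      rw [integral_neg, integral_add i1 j1, i2, j2]
    · obtain ⟨i1, i2⟩ := integral_resolventSum_taylor_div_rpow q n h hα₂ ha hw hw₁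
      obtain ⟨j1, j2⟩ := integral_resolventSum_taylor_div_rpow q n h hα₂ ha hw' hw₁'
      have z3 : resolventSum (fun j => -(-w) * (j + 1 : ℕ) * q j) n 2 (1 + w * x) (-w) 0 =
          -resolventSum (fun j => -w * (j + 1 : ℕ) * q j) n 2 (1 + w * x) w 0 := by
        rw [resolventSum_neg]
        simp [resolventSum]
      have e : ∀ y : ℝ, (2 * (1 + resolventSum q n 1 1 w x) -
          (1 + resolventSum q n 1 1 w (x + y)) - (1 + resolventSum q n 1 1 w (x - y))) /
          ((y ^ (1 + α) : ℝ) : ℂ) =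
          -((resolventSum q n 1 (1 + w * x) w y - resolventSum q n 1 (1 + w * x) w 0 -
            resolventSum (fun j => -w * (j + 1 : ℕ) * q j) n 2 (1 + w * x) w 0 * y) /
            ((y ^ (1 + α) : ℝ) : ℂ) +
          (resolventSum q n 1 (1 + w * x) (-w) y - resolventSum q n 1 (1 + w * x) (-w) 0 -
            resolventSum (fun j => -(-w) * (j + 1 : ℕ) * q j) n 2 (1 + w * x) (-w) 0 * y) /
            ((y ^ (1 + α) : ℝ) : ℂ)) := fun y => by
        rw [resolventSum_add, resolventSum_sub, z1, z2, z3]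
        ring
      simp_rw [e]
      refine ⟨(i1.add j1).neg, ?_⟩
      rw [integral_neg, integral_add i1 j1, i2, j2]
  obtain ⟨h1, h2⟩ := fracLap_of_integrableOn hα₀ hc hM key.1
  refine ⟨h1, h2.trans ?_⟩
  rw [key.2]
  linear_combination (-gammaSum q n α (1 + w * x)) *
    fracLapConst_mul_Gamma_neg hα₀ hα₂ hα₁ hw hw₁

/-- At `α = 1` the Gamma quotient is `j + 1`, and `w * (-w) = 1` identifies the sum with `w` times
the derivative. -/
theorem gammaSum_one (q : ℕ → ℂ) (n : ℕ) (hw : w.re = 0) (hw₁ : ‖w‖ = 1) (x : ℝ) :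
    gammaSum q n 1 (1 + w * x) =
      w * resolventSum (fun j => -w * (j + 1 : ℕ) * q j) n 2 1 w x := by
  have hww : w * w = -1 := by
    rcases eq_I_or_eq_neg_I hw hw₁ with rfl | rfl <;> simp
  rw [gammaSum, resolventSum, Finset.mul_sum]
  refine Finset.sum_congr rfl fun j _ => ?_
  have hj : (j : ℂ) + 1 ≠ 0 := by exact_mod_cast j.succ_ne_zero
  have hG : Complex.Gamma (j + 1) ≠ 0 := Complex.Gamma_ne_zero_of_re_pos (by simp; positivity)
  rw [Complex.ofReal_one, Complex.Gamma_add_one _ hj, mul_div_cancel_right₀ _ hG, Complex.cpow_neg,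
    show (j : ℂ) + 1 + 1 = (j + 2 : ℕ) by push_cast; ring, Complex.cpow_natCast, inv_pow]
  push_cast
  linear_combination ((j + 1) * q j * ((1 + w * x) ^ (j + 2))⁻¹) * hww

/-- One integration by parts turns the second difference over `y ^ 2` into `(v (x - y) - v (x + y))
/ y` with `v = u'`, whose integral is `π w v(x)`; the constant at `α = 1` is `1 / π`. -/
theorem fracLap_one_one_add_resolventSum (q : ℕ → ℂ) (n : ℕ) (hw : w.re = 0) (hw₁ : ‖w‖ = 1)
    (x : ℝ) :
    FracLapExists 1 (fun y => 1 + resolventSum q n 1 1 w y) x ∧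
    fracLap 1 (fun y => 1 + resolventSum q n 1 1 w y) x = gammaSum q n 1 (1 + w * x) := by
  have hw' : (-w).re = 0 := by simp [hw]
  have hw₁' : ‖-w‖ = 1 := by simp [hw₁]
  have ha := one_add_mul_ofReal_re hw x
  have h1re : (1 : ℂ).re = 1 := by simp
  set q' : ℕ → ℂ := fun j => -w * (j + 1 : ℕ) * q j with hq'
  set q'' : ℕ → ℂ := fun j => -w * (j + 2 : ℕ) * q' j with hq''
  set u : ℝ → ℂ := fun y => 1 + resolventSum q n 1 1 w y with hu
  set v : ℝ → ℂ := resolventSum q' n 2 1 w with hv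
  set M := 1 + ∑ j ∈ Finset.range n, ‖q j‖ with hMdef
  set M' := ∑ j ∈ Finset.range n, ‖q' j‖ with hM'
  set M'' := ∑ j ∈ Finset.range n, ‖q'' j‖ with hM''
  have hM₀ : 0 ≤ M := by positivity
  have hM₀' : 0 ≤ M' := by positivity
  have hM₀'' : 0 ≤ M'' := by positivity
  have hM : ∀ y, ‖u y‖ ≤ M := fun y => by
    refine (norm_add_le _ _).trans ?_
    rw [norm_one]
    exact add_le_add le_rfl (norm_resolventSum_le q n 1 h1re hw y)
  have huv : ∀ y, HasDerivAt u (v y) y := hasDerivAt_one_add_resolventSum q n hw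
  have hv' : ∀ y, HasDerivAt v (resolventSum q'' n 3 1 w y) y :=
    hasDerivAt_resolventSum q' n 2 h1re hw
  have hvc : Continuous v := continuous_resolventSum q' n 2 h1re hw
  have huc : Continuous u := continuous_iff_continuousAt.2 fun y => (huv y).continuousAt
  have hφ : ∀ y : ℝ, HasDerivAt (fun y : ℝ => 2 * u x - u (x + y) - u (x - y))
      (v (x - y) - v (x + y)) y := fun y => by
    have h1 := (huv (x + y)).comp_const_add x y
    have h2 := (huv (x - y)).comp_const_sub x y
    exact ((h1.const_sub (2 * u x)).fun_sub h2).congr_deriv (by ring)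
  have hψ : ∀ y : ℝ, HasDerivAt (fun y : ℝ => v (x - y) - v (x + y))
      (-resolventSum q'' n 3 1 w (x - y) - resolventSum q'' n 3 1 w (x + y)) y := fun y =>
    ((hv' (x - y)).comp_const_sub x y).fun_sub ((hv' (x + y)).comp_const_add x y)
  have c0 : ∀ y, 0 ≤ y → ‖v (x - y) - v (x + y)‖ ≤ 2 * M'' * y := fun y hy => by
    have := norm_sub_le_of_hasDerivAt_of_norm_le (M := 2 * M'') hy hψ fun t _ _ => by
      refine (norm_sub_le _ _).trans ?_
      rw [norm_neg, two_mul]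
      exact add_le_add (norm_resolventSum_le q'' n 3 h1re hw _)
        (norm_resolventSum_le q'' n 3 h1re hw _)
    simpa using this
  have b0 : ∀ y : ℝ, 0 < y → ‖2 * u x - u (x + y) - u (x - y)‖ ≤
      (2 * M'' + 4 * M) * y ^ (2 : ℝ) := fun y hy => by
    have := norm_sub_le_of_hasDerivAt_of_norm_le (M := 2 * M'' * y) hy.le hφ fun t ht hty =>
      (c0 t ht).trans (by gcongr)
    rw [add_zero, sub_zero, two_mul (u x), add_sub_cancel_right, sub_self, sub_zero,
      ← two_mul (u x)] at this
    rw [rpow_two]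
    nlinarith [mul_nonneg hM₀ (sq_nonneg y)]
  have b1 : ∀ y : ℝ, 0 < y → ‖2 * u x - u (x + y) - u (x - y)‖ ≤
      (2 * M'' + 4 * M) * y ^ (0 : ℝ) := fun y hy => by
    have h1 := norm_sub_le (2 * u x - u (x + y)) (u (x - y))
    have h2 := norm_sub_le (2 * u x) (u (x + y))
    rw [norm_mul, Complex.norm_ofNat] at h2
    rw [rpow_zero]
    linarith [hM x, hM (x + y), hM (x - y)]
  have hva : ∀ y, v (x - y) - v (x + y) =
      resolventSum q' n 2 (1 + w * x) (-w) y - resolventSum q' n 2 (1 + w * x) w y := fun y => by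
    rw [hv, resolventSum_add, resolventSum_sub]
  have b0' : ∀ y : ℝ, 0 < y → ‖v (x - y) - v (x + y)‖ ≤
      (2 * M'' + 2 * (M' * (1 + ‖1 + w * x‖))) * y ^ ((2 : ℝ) - 1) := fun y hy => by
    rw [show (2 : ℝ) - 1 = 1 by norm_num, rpow_one]
    have : 0 ≤ M' * (1 + ‖1 + w * x‖) * y := by positivity
    linarith [c0 y hy.le]
  have b1' : ∀ y : ℝ, 0 < y → ‖v (x - y) - v (x + y)‖ ≤
      (2 * M'' + 2 * (M' * (1 + ‖1 + w * x‖))) * y ^ ((0 : ℝ) - 1) := fun y hy => by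
    rw [zero_sub, hva]
    have h1 := norm_resolventSum_le_mul_rpow q' n one_le_two ha hw hw₁ hy
    have h2 := norm_resolventSum_le_mul_rpow q' n one_le_two ha hw' hw₁' hy
    have h3 : 0 ≤ M'' * y ^ (-1 : ℝ) := by positivity
    have h4 := norm_sub_le (resolventSum q' n 2 (1 + w * x) (-w) y)
      (resolventSum q' n 2 (1 + w * x) w y)
    linarith
  have hint : IntegrableOn (fun y : ℝ => (2 * u x - u (x + y) - u (x - y)) /
      ((y ^ ((1 : ℝ) + 1) : ℝ) : ℂ)) (Ioi 0) :=
    integrableOn_Ioi_div_rpow (by fun_prop) b0 b1 (by norm_num) (by norm_num)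
  obtain ⟨h1, h2⟩ := fracLap_of_integrableOn one_pos huc hM hint
  refine ⟨h1, h2.trans ?_⟩
  have hπ : (π : ℂ) ≠ 0 := by exact_mod_cast pi_pos.ne'
  rw [integral_Ioi_div_rpow_add_one (β := 1) hφ (by fun_prop) b0 b1 b0' b1' (by norm_num)
    (by norm_num) one_ne_zero, fracLapConst_eq one_pos one_lt_two]
  simp_rw [hva, rpow_one]
  rw [(integral_resolventSum_sub_div q' n 1 ha hw hw₁).2, resolventSum_zero, gammaSum_one q n hw hw₁,
    ← hq', one_mul, Real.sin_pi_div_two, show (1 : ℝ) + 1 = 2 by norm_num, Real.Gamma_two]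
  push_cast
  field_simp

theorem hilbertTransform_one_add_resolventSum (q : ℕ → ℂ) (n : ℕ) (hw : w.re = 0) (hw₁ : ‖w‖ = 1)
    (x : ℝ) :
    HilbertExists (fun y => 1 + resolventSum q n 1 1 w y) x ∧
    hilbertTransform (fun y => 1 + resolventSum q n 1 1 w y) x = w * resolventSum q n 1 1 w x := by
  have ha := one_add_mul_ofReal_re hw x
  have hπ : (π : ℂ) ≠ 0 := by exact_mod_cast pi_pos.ne'
  have e : ∀ y : ℝ, ((1 + resolventSum q n 1 1 w (x - y)) - (1 + resolventSum q n 1 1 w (x + y))) / y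
      = (resolventSum q n 1 (1 + w * x) (-w) y - resolventSum q n 1 (1 + w * x) w y) / y := by
    intro y
    rw [resolventSum_add, resolventSum_sub, add_sub_add_left_eq_sub]
  obtain ⟨i1, i2⟩ := integral_resolventSum_sub_div q n 0 ha hw hw₁
  obtain ⟨h1, h2⟩ := hilbert_of_integrableOn (u := fun y => 1 + resolventSum q n 1 1 w y) (x := x)
    (continuous_const.add (continuous_resolventSum q n 1 (by simp) hw)) (by simp_rw [e]; exact i1)
  refine ⟨h1, h2.trans ?_⟩
  simp_rw [e]
  rw [i2, resolventSum_zero]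
  field_simp

/-- The left half-line contributes `(-w) ^ α`, the right one `w ^ α`, which is the combination in
`Gamma_neg_mul_rfConst`. At `α = 1` the phase comes from `-cos G * w + sin G = -(cos G + w sin G) *
w`, where `G = γ π / 2`. -/
theorem rieszFeller_one_add_resolventSum (q : ℕ → ℂ) (n : ℕ) (hw : w.re = 0) (hw₁ : ‖w‖ = 1)
    {α : ℝ} (γ : ℝ) (hα₀ : 0 < α) (hα₂ : α < 2) (x : ℝ) :
    RieszFellerExists α (fun y => 1 + resolventSum q n 1 1 w y) x ∧
    rieszFeller α γ (fun y => 1 + resolventSum q n 1 1 w y) x =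
      -Complex.exp (w * (γ * (π / 2) : ℝ)) * gammaSum q n α (1 + w * x) := by
  have hw' : (-w).re = 0 := by simp [hw]
  have hw₁' : ‖-w‖ = 1 := by simp [hw₁]
  have hww : w * w = -1 := by
    rcases eq_I_or_eq_neg_I hw hw₁ with rfl | rfl <;> simp
  have ha := one_add_mul_ofReal_re hw x
  set q' : ℕ → ℂ := fun j => -w * (j + 1 : ℕ) * q j with hq'
  have hder := hasDerivAt_one_add_resolventSum q n hw
  have hdiff : Differentiable ℝ fun y => 1 + resolventSum q n 1 1 w y := fun y =>
    (hder y).differentiableAt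
  have hd : ∀ y, deriv (fun y => 1 + resolventSum q n 1 1 w y) y = resolventSum q' n 2 1 w y :=
    fun y => (hder y).deriv
  have d1 : ∀ z, resolventSum q' n 2 1 w (x - z) = -resolventSum (fun j => -(-w) * (j + 1 : ℕ) * q j)
      n 2 (1 + w * x) (-w) z := fun z => by
    rw [resolventSum_neg, neg_neg, resolventSum_sub]
  have z1 := resolventSum_zero q n 1 1 w x
  have z2 : resolventSum q n 1 (1 + w * x) (-w) 0 = resolventSum q n 1 1 w x := by
    rw [← z1]
    simp [resolventSum]
  have z3 := resolventSum_zero q' n 2 1 w x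
  have z4 : resolventSum (fun j => -(-w) * (j + 1 : ℕ) * q j) n 2 (1 + w * x) (-w) 0 =
      -resolventSum q' n 2 1 w x := by
    rw [resolventSum_neg, ← z3]
    simp [resolventSum, hq']
  rcases lt_trichotomy α 1 with h | h | h
  · obtain ⟨i1, i2, -, -⟩ := integral_resolventSum_sub_div_rpow q n hα₀ h ha hw hw₁
    obtain ⟨j1, j2, -, -⟩ := integral_resolventSum_sub_div_rpow q n hα₀ h ha hw' hw₁'
    have hG := Gamma_neg_ne_zero hα₀ hα₂ h.ne
    have hα : (α : ℂ) ≠ 0 := by exact_mod_cast hα₀.ne'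
    refine ⟨⟨hdiff, fun _ => ?_, fun h' => absurd h' h.ne, fun h' => absurd h' h.not_gt⟩, ?_⟩
    · simp_rw [hd, d1, resolventSum_add, neg_div]
      exact ⟨j1.neg, i1⟩
    · rw [rieszFeller, if_pos h, weylMarchaud, weylMarchaudBar]
      simp_rw [hd, d1, resolventSum_add, neg_div]
      rw [integral_neg, i2, j2, ← Complex.Gamma_ofReal, ← Complex.Gamma_ofReal, Complex.ofReal_sub,
        Complex.ofReal_one, Complex.ofReal_neg, show (1 : ℂ) - α = -α + 1 by ring,
        Complex.Gamma_add_one _ (neg_ne_zero.2 hα), ← Gamma_neg_mul_rfConst hα₀ hα₂ h.ne hw hw₁]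
      field_simp
      ring
  · subst h
    have hH : ∀ y, hilbertTransform (fun y => 1 + resolventSum q n 1 1 w y) y =
        w * resolventSum q n 1 1 w y := fun y =>
      (hilbertTransform_one_add_resolventSum q n hw hw₁ y).2
    have hHd : HasDerivAt (hilbertTransform (fun y => 1 + resolventSum q n 1 1 w y))
        (w * resolventSum q' n 2 1 w x) x := by
      rw [funext hH]
      exact (hasDerivAt_resolventSum q n 1 (by simp) hw x).const_mul w
    refine ⟨⟨hdiff, fun h' => absurd h' (lt_irrefl _), fun _ =>
      ⟨fun y => (hilbertTransform_one_add_resolventSum q n hw hw₁ y).1, hHd.differentiableAt⟩,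
      fun h' => absurd h' (lt_irrefl _)⟩, ?_⟩
    rw [rieszFeller, if_neg (lt_irrefl _), if_pos rfl, hHd.deriv, hd, gammaSum_one q n hw hw₁,
      exp_eq_cos_add_sin hw hw₁]
    linear_combination (Real.sin (γ * (π / 2)) * resolventSum q' n 2 1 w x : ℂ) * hww
  · obtain ⟨i1, i2⟩ := integral_resolventSum_taylor_div_rpow q n h hα₂ ha hw hw₁
    obtain ⟨j1, j2⟩ := integral_resolventSum_taylor_div_rpow q n h hα₂ ha hw' hw₁'
    have hG := Gamma_neg_ne_zero hα₀ hα₂ h.ne'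
    rw [z1, z3] at i1 i2
    rw [z2, z4] at j1 j2
    simp only [neg_mul, sub_neg_eq_add] at j1 j2
    refine ⟨⟨hdiff, fun h' => absurd h' h.not_gt, fun h' => absurd h' h.ne', fun _ => ?_⟩, ?_⟩
    · simp_rw [hd, add_sub_add_left_eq_sub, resolventSum_add, resolventSum_sub]
      exact ⟨j1, i1⟩
    · rw [rieszFeller, if_neg h.not_gt, if_neg h.ne', dWeylMarchaud, dWeylMarchaudBar,
        show -1 - (α - 1) = -α by ring, show 2 + (α - 1) = 1 + α by ring]
      simp_rw [hd, add_sub_add_left_eq_sub, resolventSum_add, resolventSum_sub]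
      rw [i2, j2, ← Complex.Gamma_ofReal, Complex.ofReal_neg,
        ← Gamma_neg_mul_rfConst hα₀ hα₂ h.ne' hw hw₁]
      field_simp

theorem fracLap_one_add_resolventSum (q : ℕ → ℂ) (n : ℕ) (hw : w.re = 0) (hw₁ : ‖w‖ = 1)
    {α : ℝ} (hα₀ : 0 < α) (hα₂ : α < 2) (x : ℝ) :
    FracLapExists α (fun y => 1 + resolventSum q n 1 1 w y) x ∧
    fracLap α (fun y => 1 + resolventSum q n 1 1 w y) x = gammaSum q n α (1 + w * x) := by
  rcases eq_or_ne α 1 with rfl | h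
  · exact fracLap_one_one_add_resolventSum q n hw hw₁ x
  · exact fracLap_one_add_resolventSum_of_ne_one q n hw hw₁ hα₀ hα₂ h x

end

/-! ### The terminating hypergeometric series. -/

theorem ascPochhammer_eval_mul_Gamma {s : ℂ} (hs : 0 < s.re) (j : ℕ) :
    (ascPochhammer ℂ j).eval s * Complex.Gamma s = Complex.Gamma (s + j) := by
  induction j with
  | zero => simp
  | succ j ih =>
    have h0 : s + j ≠ 0 := by
      intro h
      have := congrArg Complex.re h
      simp at this
      have : (0 : ℝ) ≤ j := j.cast_nonneg
      linarith
    rw [ascPochhammer_succ_eval, mul_right_comm, ih, mul_comm, ← Complex.Gamma_add_one _ h0]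
    push_cast
    congr 1; ring

/-- This converts binomial coefficients into Pochhammer symbols; for `n ≠ 0` it also shows that the
symbol vanishes for `j ≥ n`, so the series terminates. -/
theorem natCast_mul_ascPochhammer_eval_one_sub (n j : ℕ) :
    (n : ℂ) * (ascPochhammer ℂ j).eval (1 - n : ℂ) =
      (-1) ^ j * ((j + 1).factorial * n.choose (j + 1)) := by
  induction j with
  | zero => simp
  | succ j ih =>
    have h : (n.choose (j + 2) : ℂ) * (j + 2) = n.choose (j + 1) * (n - (j + 1)) := by
      rcases le_or_gt (j + 1) n with h | h
      · have := congrArg (Nat.cast : ℕ → ℂ) (Nat.choose_succ_right_eq n (j + 1))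
        push_cast [Nat.cast_sub h] at this
        rw [← this]
        ring
      · rw [Nat.choose_eq_zero_of_lt h, Nat.choose_eq_zero_of_lt (by lia)]
        simp
    rw [ascPochhammer_succ_eval, ← mul_assoc, ih, Nat.factorial_succ (j + 1)]
    push_cast
    linear_combination (-1) ^ j * ((j + 1).factorial : ℂ) * h

theorem ascPochhammer_eval_two (j : ℕ) :
    (ascPochhammer ℂ j).eval (2 : ℂ) = (j + 1).factorial := by
  induction j with
  | zero => simp
  | succ j ih =>
    rw [ascPochhammer_succ_eval, ih, Nat.factorial_succ (j + 1)]
    push_cast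
    ring

theorem gammaSum_eq_ordinaryHypergeometric (n : ℕ) {α : ℝ} (hα : 0 < α) {a : ℂ} (ha : a ≠ 0) :
    -gammaSum (fun j => n.choose (j + 1) * (-2) ^ (j + 1)) n α a =
      2 * n * Complex.Gamma (1 + α) / a ^ ((1 : ℂ) + α) *
        ordinaryHypergeometric ((1 : ℂ) - n) ((1 : ℂ) + α) (2 : ℂ) (2 / a) := by
  rcases Nat.eq_zero_or_pos n with rfl | hn
  · simp [gammaSum]
  rw [ordinaryHypergeometric_eq_tsum]
  dsimp only
  rw [tsum_eq_sum (s := Finset.range n), gammaSum, Finset.mul_sum, ← Finset.sum_neg_distrib]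
  · refine Finset.sum_congr rfl fun j _ => ?_
    have h1 := ascPochhammer_eval_mul_Gamma (s := 1 + α) (by simp; positivity) j
    have h2 := natCast_mul_ascPochhammer_eval_one_sub n j
    have h3 : a ^ (-(j + 1 + α) : ℂ) = (a ^ ((1 : ℂ) + α))⁻¹ * (a ^ j)⁻¹ := by
      rw [show (-(j + 1 + α) : ℂ) = -(1 + α) + -j by ring, Complex.cpow_add _ _ ha,
        Complex.cpow_neg, Complex.cpow_neg, Complex.cpow_natCast]
    have hf : ((j + 1).factorial : ℂ) ≠ 0 := by exact_mod_cast (j + 1).factorial_ne_zero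
    have hf' : (j.factorial : ℂ) ≠ 0 := by exact_mod_cast j.factorial_ne_zero
    rw [h3, ascPochhammer_eval_two, Complex.Gamma_nat_eq_factorial, smul_eq_mul, div_pow,
      show (j : ℂ) + 1 + α = 1 + α + j by ring, ← h1, pow_succ, neg_pow]
    generalize (ascPochhammer ℂ j).eval ((1 : ℂ) + α) = X
    generalize (ascPochhammer ℂ j).eval ((1 : ℂ) - n) = Y at *
    generalize (a ^ ((1 : ℂ) + α)) = Z
    generalize Complex.Gamma (1 + α) = G
    calc _ = ((-1) ^ j * ((j + 1).factorial * n.choose (j + 1))) * (2 * G / Z *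
          ((j.factorial : ℂ)⁻¹ * X * ((j + 1).factorial : ℂ)⁻¹ * (2 ^ j / a ^ j))) := by
          field_simp
      _ = _ := by rw [← h2]; ring
  · intro j hj
    rw [Finset.mem_range, not_lt] at hj
    have h2 := natCast_mul_ascPochhammer_eval_one_sub n j
    rw [Nat.choose_eq_zero_of_lt (by lia), Nat.cast_zero, mul_zero, mul_zero, mul_eq_zero] at h2
    rw [h2.resolve_left (by exact_mod_cast hn.ne')]
    simp

/-! ### Higgins functions as resolvent sums, and the theorem. -/

theorem one_sub_two_mul_inv_pow (n : ℕ) (w : ℂ) (y : ℝ) :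
    (1 - 2 * (1 + w * y)⁻¹) ^ n =
      1 + resolventSum (fun j => n.choose (j + 1) * (-2) ^ (j + 1)) n 1 1 w y := by
  rw [show 1 - 2 * (1 + w * y)⁻¹ = -2 * (1 + w * y)⁻¹ + 1 by ring, add_pow,
    Finset.sum_range_succ', add_comm, resolventSum]
  congr 1
  · simp
  · refine Finset.sum_congr rfl fun j _ => ?_
    rw [mul_pow, one_pow]
    ring

theorem higgins_natCast (n : ℕ) : higgins n =
    fun y => 1 + resolventSum (fun j => n.choose (j + 1) * (-2) ^ (j + 1)) n 1 1 Complex.I y := by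
  ext y
  have h := add_mul_ne_zero Complex.one_re Complex.I_re y
  rw [higgins, zpow_natCast, ← one_sub_two_mul_inv_pow]
  congr 1
  rw [add_comm _ (1 : ℂ)]
  field_simp
  ring

theorem higgins_neg_natCast (n : ℕ) : higgins (-n) =
    fun y => 1 + resolventSum (fun j => n.choose (j + 1) * (-2) ^ (j + 1)) n 1 1 (-Complex.I) y := by
  ext y
  have h := add_mul_ne_zero Complex.one_re Complex.I_re y
  have h' := add_mul_ne_zero Complex.one_re (w := -Complex.I) (by simp) y
  have h'' : Complex.I * y - 1 ≠ 0 := fun h => h' (by linear_combination -h)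
  rw [higgins, zpow_neg, zpow_natCast, ← one_sub_two_mul_inv_pow, ← inv_pow, inv_div]
  congr 1
  rw [div_eq_iff h'']
  linear_combination (-2) * mul_inv_cancel₀ h'

/-- Inverting the base amounts to replacing `I` by `-I`, which handles negative `k`. For `k = 0` the
sum is empty and the choice of `w` is immaterial. -/
theorem exists_higgins_eq (k : ℤ) : ∃ w : ℂ, w.re = 0 ∧ ‖w‖ = 1 ∧
    (k ≠ 0 → w = Complex.I * (k.sign : ℂ)) ∧ higgins k = fun y => 1 +
      resolventSum (fun j => k.natAbs.choose (j + 1) * (-2) ^ (j + 1)) k.natAbs 1 1 w y := by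
  rcases lt_or_ge k 0 with h | h
  · refine ⟨-Complex.I, by simp, by simp, fun _ => by simp [Int.sign_eq_neg_one_of_neg h], ?_⟩
    rw [← higgins_neg_natCast, Int.ofNat_natAbs_of_nonpos h.le, neg_neg]
  · refine ⟨Complex.I, by simp, by simp, fun hk => ?_, ?_⟩
    · simp [Int.sign_eq_one_of_pos (lt_of_le_of_ne h hk.symm)]
    · rw [← higgins_natCast, Int.natAbs_of_nonneg h]

/-- Computed from `(I x - 1) / (I x + 1) = (x + I) / (x - I)` and `1 + x ^ 2 = (x + I) (x - I)`;
this supplies the closed form at `α = 1`. -/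
theorem hasDerivAt_higgins (k : ℤ) (x : ℝ) :
    HasDerivAt (higgins k) (-2 * Complex.I * k * ((x : ℂ) + Complex.I) ^ (2 * k) /
      (1 + (x : ℂ) ^ 2) ^ (1 + k)) x := by
  have h1 : (x : ℂ) + Complex.I ≠ 0 := fun h => by simpa using congrArg Complex.im h
  have h2 : (x : ℂ) - Complex.I ≠ 0 := fun h => by simpa using congrArg Complex.im h
  have e1 : Complex.I * x - 1 = Complex.I * (x + Complex.I) := by
    linear_combination -Complex.I_mul_I
  have e2 : Complex.I * x + 1 = Complex.I * (x - Complex.I) := by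
    linear_combination Complex.I_mul_I
  have e3 : 1 + (x : ℂ) ^ 2 = (x + Complex.I) * (x - Complex.I) := by
    linear_combination Complex.I_mul_I
  have h3 : Complex.I * x + 1 ≠ 0 := e2 ▸ mul_ne_zero Complex.I_ne_zero h2
  have h4 : (Complex.I * x - 1) / (Complex.I * x + 1) = (x + Complex.I) / (x - Complex.I) := by
    rw [e1, e2, mul_div_mul_left _ _ Complex.I_ne_zero]
  have hI : HasDerivAt (fun y : ℝ => Complex.I * y) Complex.I x := by
    simpa using (Complex.ofRealCLM.hasDerivAt (x := x)).const_mul Complex.I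
  have hz := hasDerivAt_zpow k ((Complex.I * x - 1) / (Complex.I * x + 1))
    (Or.inl (h4 ▸ div_ne_zero h1 h2))
  have := HasDerivAt.comp x hz ((hI.sub_const 1).fun_div (hI.add_const 1) h3)
  refine this.congr_deriv ?_
  rw [h4, e3, mul_zpow, two_mul k, zpow_add₀ h1, zpow_add₀ h1, zpow_add₀ h2, div_zpow,
    zpow_sub_one₀ h1, zpow_sub_one₀ h2, zpow_one, zpow_one, e2]
  have h5 : ((x : ℂ) + Complex.I) ^ k ≠ 0 := zpow_ne_zero _ h1
  have h6 : ((x : ℂ) - Complex.I) ^ k ≠ 0 := zpow_ne_zero _ h2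
  field_simp
  ring_nf
  simp only [Complex.I_sq]
  ring

theorem mainTheorem2 (α γ : ℝ) (hα₀ : 0 < α) (hα₂ : α < 2) (hγ : |γ| ≤ min α (2 - α))
    (k : ℤ) (x : ℝ) :
    FracLapExists α (higgins k) x ∧
    RieszFellerExists α (higgins k) x ∧
    rieszFeller α γ (higgins k) x =
      -Complex.exp (Complex.I * (k.sign : ℂ) * γ * (π / 2)) * fracLap α (higgins k) x ∧
    rieszFeller α γ (higgins k) x =
      2 * Complex.exp (Complex.I * (k.sign : ℂ) * γ * (π / 2)) * ((|k| : ℤ) : ℂ) *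
          (Real.Gamma (1 + α) : ℂ) / (Complex.I * (k.sign : ℂ) * x + 1) ^ ((1 : ℂ) + α) *
        ordinaryHypergeometric ((1 : ℂ) - ((|k| : ℤ) : ℂ)) ((1 : ℂ) + α) (2 : ℂ)
          (2 / (Complex.I * (k.sign : ℂ) * x + 1)) ∧
    (α = 1 →
      rieszFeller 1 γ (higgins k) x =
        -(2 * Complex.exp (Complex.I * (k.sign : ℂ) * γ * (π / 2)) * ((|k| : ℤ) : ℂ) *
            ((x : ℂ) + Complex.I) ^ (2 * k) / (1 + (x : ℂ) ^ 2) ^ (1 + k))) := by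
  obtain ⟨w, hw, hw₁, hwk, hk⟩ := exists_higgins_eq k
  have hkd := hasDerivAt_higgins k x
  rw [hk] at hkd ⊢
  obtain ⟨f1, f2⟩ := fracLap_one_add_resolventSum
    (fun j => k.natAbs.choose (j + 1) * (-2) ^ (j + 1)) k.natAbs hw hw₁ hα₀ hα₂ x
  obtain ⟨r1, r2⟩ := rieszFeller_one_add_resolventSum
    (fun j => k.natAbs.choose (j + 1) * (-2) ^ (j + 1)) k.natAbs hw hw₁ γ hα₀ hα₂ x
  refine ⟨f1, r1, ?_⟩
  -- For `k = 0` the chosen `w` is not `I * sign k = 0`, so the phases would not match; all terms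
  -- vanish instead.
  rcases eq_or_ne k 0 with rfl | h0
  · have hg : ∀ β a, gammaSum (fun j => (Int.natAbs 0).choose (j + 1) * (-2) ^ (j + 1))
        (Int.natAbs 0) β a = 0 := fun β a => by simp [gammaSum]
    rw [hg, mul_zero] at r2
    rw [hg] at f2
    refine ⟨by rw [r2, f2, mul_zero], by rw [r2]; simp, ?_⟩
    rintro rfl
    rw [r2]
    simp
  · have hexp : Complex.I * (k.sign : ℂ) * γ * (π / 2) = w * (γ * (π / 2) : ℝ) := by
      rw [hwk h0]
      push_cast
      ring
    have habs : ((|k| : ℤ) : ℂ) = (k.natAbs : ℂ) := by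
      rw [Int.abs_eq_natAbs]
      simp
    rw [hexp]
    refine ⟨by rw [r2, f2], ?_, ?_⟩
    · have key := gammaSum_eq_ordinaryHypergeometric k.natAbs hα₀
        (a := 1 + w * x) (add_mul_ne_zero Complex.one_re hw x)
      rw [r2, neg_mul, ← mul_neg, key, ← hwk h0, habs, ← Complex.Gamma_ofReal, add_comm (w * x)]
      push_cast
      ring
    · rintro rfl
      rw [r2, gammaSum_one _ _ hw hw₁,
        -- Uniqueness of the derivative trades the resolvent sum for the closed form.
        (hasDerivAt_one_add_resolventSum _ _ hw x).unique hkd, habs]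
      have hsk : (k.sign : ℂ) * k = k.natAbs := by
        rw [← habs, ← Int.sign_mul_self_eq_abs k]
        push_cast
        ring
      rw [← hsk, hwk h0]
      linear_combination (2 * Complex.exp (Complex.I * k.sign * (γ * (π / 2) : ℝ)) * (k.sign * k) *
        ((x : ℂ) + Complex.I) ^ (2 * k) / (1 + (x : ℂ) ^ 2) ^ (1 + k)) * Complex.I_mul_I
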